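/- **Setting.** There are $K\ge 1$ arms and $T\ge 1$ rounds; gains lie in $[0,1]$. $\mathrm{EXP3}$ with parameter $\gamma$ plays arm $i$ with probability $$p_i=(1-\gamma)\frac{e^{\gamma \tilde G_i/K}}{\sum_{j}e^{\gamma \tilde G_j/K}}+\frac{\gamma}{K},$$ where initially $\tilde G=0$, and after playing arm $I$ and observing the gain $x$ it adds $x/p_I$ to $\tilde G_I$. $\mathrm{EXP3}_\tau$ ($\tau$ a positive integer) divides the rounds into consecutive blocks of $\tau$ rounds; at the beginning of a block it takes an arm from $\mathrm{EXP3}$, plays it throughout the block, and at the end of the block feeds $\mathrm{EXP3}$ with the average gain received in the block. Here $\mathrm{EXP3}$ is run with the standard parameter $\gamma=\min\{1,\sqrt{K\ln K/((e-1)n)}\}$ for $n=\lceil T/\tau\rceil$, the number of blocks. An algorithm is $(\varepsilon,\delta)$-differentially private up to round $T$ if for any two gain sequences $g,g'$ (gains of all arms in all rounds, in $[0,1]$) that differ in at most one round and every set $S$ of sequences of $T$ arms, $\Pr(I_{1:T}\in S\mid g)\le \delta+e^{\varepsilon}\Pr(I_{1:T}\in S\mid g')$. The switching costs adversary has a gain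 table $(g_{i,t})$ with entries in $[0,1]$, which may be random but does not depend on the algorithm's choices. It grants $g_{I_t,t}$ in round $t$ if $t=1$ or $I_t=I_{t-1}$, and $0$ if $I_t\ne I_{t-1}$. The expected regret is the expectation, over the choices of adversary and algorithm, of $\max_i\sum_{t=1}^T g_{i,t}$ (the total gain of the best fixed arm) minus the total gain of the algorithm. **Statement.** For $\varepsilon>0$ and $0<\delta<1$ let $$\tau=\left\lceil\left(\frac{4T\varepsilon+2T\ln\frac1\delta}{\varepsilon^2}\right)^{1/3}\right\rceil .$$ 1. For all $K\ge1$, $T\ge 1$, $\varepsilon>0$ and $0<\delta<1$, $\mathrm{EXP3}_\tau$ is $(\varepsilon,\delta)$-differentially private up to round $T$. 2. For every $c>0$ there is a constant $C>0$, depending only on $c$, such that for all $K\ge 2$, $T\ge1$, $\varepsilon>0$ and $0<\delta<1$ with $\varepsilon\le c\ln\frac1\delta$ and $\varepsilon^2\le c\,K\ln K\,\ln\frac1\delta$ (with $c=1$ this covers all $\varepsilon\le 1$, $\delta\le 1/e$), the expected regret of $\mathrm{EXP3}_\tau$ after $T$ rounds against every switching costs adversary is well defined (the conditional expectation of the regret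 given the gain table is integrable) and at most $$C\,T^{2/3}\sqrt{K\ln K}\left(\frac{\sqrt{\ln\frac1\delta}}{\varepsilon}\right)^{1/3}.$$ -/

import Mathlib

open scoped ENNReal
open MeasureTheory

noncomputable section

namespace PrivateBandit

/-- A randomized bandit algorithm with arms `0, …, K - 1`: it maps every history of
(arm, observed gain) pairs, listed with the most recent round first, to a distribution over the
next arm. -/
abbrev Algorithm (K : ℕ) := List (Fin K × ℝ) → PMF (Fin K)

/-- A (deterministic, reactive) adversary. Rounds are numbered from `0`; `adv t I` is the gain
granted in round `t` when the arms played in rounds `0, …, t` are `I 0, …, I t`. -/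
abbrev Adversary (K : ℕ) := (t : ℕ) → (Fin (t + 1) → Fin K) → ℝ

/-- What an algorithm has observed after `t` rounds in which the arms `I` were played. -/
def history {K : ℕ} (adv : Adversary K) : (t : ℕ) → (Fin t → Fin K) → List (Fin K × ℝ)
  | 0, _ => []
  | t + 1, I => (I (Fin.last t), adv t I) :: history adv t (Fin.init I)

/-- The joint law of the arms `I 0, …, I (T - 1)` played by the algorithm `Λ`. -/
def law {K : ℕ} (Λ : Algorithm K) (adv : Adversary K) : (T : ℕ) → PMF (Fin T → Fin K)
  | 0 => PMF.pure Fin.elim0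
  | T + 1 => (law Λ adv T).bind fun I =>
      (Λ (history adv T I)).map fun a => (Fin.snoc I a : Fin (T + 1) → Fin K)

/-- The adversary that always grants the gain `g t i` to arm `i` in round `t`. -/
def oblivious {K : ℕ} (g : ℕ → Fin K → ℝ) : Adversary K :=
  fun t I => g t (I (Fin.last t))

open Classical in
/-- The switching costs adversary with gain table `g`: arm `i` earns `g t i` in round `t`, except
that the gain is `0` if the arm played in round `t` differs from the one of round `t - 1`. (There
is no penalty in round `0`.) -/
def switchingCosts {K : ℕ} (g : ℕ → Fin K → ℝ) : Adversary K :=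
  fun t I => if ∀ s : Fin (t + 1), (s : ℕ) + 1 = t → I s = I (Fin.last t)
    then g t (I (Fin.last t)) else 0

/-! ### Differential privacy -/

/-- `Λ` is `(ε, δ)`-differentially private up to round `T`: for gain sequences in `[0, 1]` (gains of
all arms) that differ in at most one round, and every set `S` of sequences of `T` arms. The gains
of the last round and of later ones do not influence the first `T` arms. -/
def IsDifferentiallyPrivate {K : ℕ} (Λ : Algorithm K) (T : ℕ) (ε δ : ℝ) : Prop :=
  ∀ g g' : ℕ → Fin K → ℝ,
    (∀ t i, g t i ∈ Set.Icc (0 : ℝ) 1) → (∀ t i, g' t i ∈ Set.Icc (0 : ℝ) 1) →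
    (∃ s, ∀ t, t ≠ s → g t = g' t) →
    ∀ S : Set (Fin T → Fin K),
      (law Λ (oblivious g) T).toOuterMeasure S ≤
        ENNReal.ofReal δ +
          (law Λ (oblivious g') T).toOuterMeasure S * ENNReal.ofReal (Real.exp ε)

/-! ### Regret -/

/-- The total gain over `T` rounds of an agent that plays the arms `I`. -/
def totalGain {K : ℕ} (adv : Adversary K) (T : ℕ) (I : Fin T → Fin K) : ℝ :=
  ∑ t : Fin T, adv t fun s => I (Fin.castLE t.isLt s)

/-- The regret after `T` rounds for the arms `I`, against the fixed oracle, the agent who plays the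
best fixed arm in every round (and meets the same adversary). -/
def regret {K : ℕ} (adv : Adversary K) (T : ℕ) (I : Fin T → Fin K) : ℝ :=
  (⨆ i : Fin K, totalGain adv T fun _ => i) - totalGain adv T I

/-- Expectation of the regret over the random choices of the algorithm. -/
def expectedRegret {K : ℕ} (Λ : Algorithm K) (adv : Adversary K) (T : ℕ) : ℝ :=
  ∑ I : Fin T → Fin K, (law Λ adv T I).toReal * regret adv T I

/-! ### EXP3 -/

/-- The EXP3 probability of arm `i` when the estimated cumulative gains are `G`. -/
def exp3Prob {K : ℕ} (γ : ℝ) (G : Fin K → ℝ) (i : Fin K) : ℝ :=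
  (1 - γ) * (Real.exp (γ / K * G i) / ∑ j, Real.exp (γ / K * G j)) + γ / K

/-- The importance-weighted estimates of the cumulative gains after a history. -/
def exp3Estimate {K : ℕ} (γ : ℝ) : List (Fin K × ℝ) → Fin K → ℝ
  | [] => fun _ => 0
  | (a, x) :: h => fun i =>
      exp3Estimate γ h i + if i = a then x / exp3Prob γ (exp3Estimate γ h) i else 0

theorem exp3Prob_nonneg {K : ℕ} {γ : ℝ} (h0 : 0 ≤ γ) (h1 : γ ≤ 1) (G : Fin K → ℝ) (i : Fin K) :
    0 ≤ exp3Prob γ G i := by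
  have : 0 ≤ 1 - γ := by linarith
  unfold exp3Prob
  positivity

theorem sum_exp3Prob {K : ℕ} [NeZero K] (γ : ℝ) (G : Fin K → ℝ) :
    ∑ i, exp3Prob γ G i = 1 := by
  have hK : (K : ℝ) ≠ 0 := Nat.cast_ne_zero.mpr (NeZero.ne K)
  have hs : (∑ j, Real.exp (γ / K * G j)) ≠ 0 :=
    (Finset.sum_pos (fun j _ => Real.exp_pos _) Finset.univ_nonempty).ne'
  unfold exp3Prob
  rw [Finset.sum_add_distrib, ← Finset.mul_sum, ← Finset.sum_div, div_self hs]
  simp only [Finset.sum_const, Finset.card_univ, Fintype.card_fin, nsmul_eq_mul]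
  field_simp
  ring

/-- EXP3 with parameter `γ ∈ [0, 1]`. -/
def exp3 {K : ℕ} [NeZero K] (γ : unitInterval) : Algorithm K := fun h =>
  PMF.ofFintype (fun i => ENNReal.ofReal (exp3Prob γ (exp3Estimate γ h) i)) (by
    rw [← ENNReal.ofReal_sum_of_nonneg fun i _ => exp3Prob_nonneg γ.2.1 γ.2.2 _ i,
      sum_exp3Prob, ENNReal.ofReal_one])

/-- The standard parameter of EXP3 for `n` rounds,
`γ = min {1, √(K ln K / ((e - 1) n))}`. -/
def exp3Rate (K n : ℕ) : unitInterval :=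
  ⟨min 1 (Real.sqrt (K * Real.log K / ((Real.exp 1 - 1) * n))),
    le_min zero_le_one (Real.sqrt_nonneg _), min_le_left _ _⟩

/-! ### The mini-batch wrapper -/

/-- The history of complete blocks of `τ` rounds (most recent block first): each block is
summarized by its arm and the average of the gains received in it. -/
def blockHistory {K : ℕ} [NeZero K] (τ : ℕ) (h : List (Fin K × ℝ)) : List (Fin K × ℝ) :=
  (List.range (h.length / τ)).map fun j =>
    let block := (h.drop (j * τ)).take τ
    ((block.map Prod.fst).headD 0, (block.map Prod.snd).sum / τ)

/-- The wrapper that takes an arm from `Λ` at the beginning of every block of `τ` rounds, plays it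
in the whole block, and then feeds `Λ` with the average gain of the block. -/
def miniBatch {K : ℕ} [NeZero K] (τ : ℕ) (Λ : Algorithm K) : Algorithm K
  | [] => Λ []
  | (a, x) :: h =>
      if τ ∣ h.length + 1 then Λ (blockHistory τ ((a, x) :: h)) else PMF.pure a

/-- EXP3 in blocks of `τ` rounds over a horizon of `T` rounds; EXP3 itself is tuned for the number
`⌈T / τ⌉` of blocks, the number of rounds in which it acts. -/
def exp3Tau (K T τ : ℕ) [NeZero K] : Algorithm K :=
  miniBatch τ (exp3 (exp3Rate K ⌈(T : ℝ) / τ⌉₊))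

/-- The block length `((4 T ε + 2 T ln (1/δ)) / ε²)^(1/3)`, rounded up to an integer. -/
def blockLength (T : ℕ) (ε δ : ℝ) : ℕ :=
  ⌈((4 * T * ε + 2 * T * Real.log (1 / δ)) / ε ^ 2) ^ (1 / 3 : ℝ)⌉₊

end PrivateBandit

end

noncomputable section

namespace PrivateBandit

/-! ### The law of the arms -/

/-! Write L = ln(1/δ) and η = γ/K.

Privacy. Fix the arms played and change one gain by at most d. Then the log-probabilities of the
next EXP3 arm change by at most d, however many rounds have passed since, for every γ in [0, 1]. The
invariant (`exp3Estimate_adjacent`) is that η(G - G') has oscillation at most d over the arms. The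
changed round creates a single jump of size at most d, because η/p ≤ 1. Afterwards equal gains never
widen the range: where G is ahead of G', arm i has the larger p, so the importance-weighted
increment of G is smaller, and `div_exp3Prob_sub_le` shows that it cannot overshoot the extreme.
Averaging over a block reduces the change to d = 1/τ, and an arm is drawn only at block starts. The
squared log-ratios of all rounds therefore sum to at most T/τ³. Adaptive composition
(`toOuterMeasure_law_le`) bounds moments of the likelihood ratio by a Hoeffding estimate and applies
Markov's inequality. The block length is what makes the resulting error at most δ.

Regret. The potential ln(∑ exp(ηG_j)) - ηG_i starts at ln K and stays nonnegative. Its expected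
change in one EXP3 step (`sum_exp3Prob_mul_potential_le`) controls the gain of arm i minus the
expected gain of the algorithm. The step inequality holds conditionally on the past, so it applies
to block averages that already include the switching penalty; the penalty costs at most 1 per block.
Telescoping over n blocks gives regret at most τ(1-γ)K ln K/γ + n(1 + 2γτ), which the standard γ
turns into 4τ√(nK ln K) + n. Both terms have the claimed order for the prescribed τ, unless rounding
spoils τ or n; there the trivial bound T on the regret is enough. A random gain table is handled by
integrating the bound for fixed tables. -/

theorem sum_snoc {K T : ℕ} {M : Type*} [AddCommMonoid M] (f : (Fin (T + 1) → Fin K) → M) :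
    ∑ J, f J = ∑ I : Fin T → Fin K, ∑ a : Fin K, f (Fin.snoc I a : Fin (T + 1) → Fin K) := by
  rw [← (Fin.snocEquiv fun _ : Fin (T + 1) => Fin K).sum_comp, Fintype.sum_prod_type,
    Finset.sum_comm]
  rfl

theorem snoc_injective {K T : ℕ} {I J : Fin T → Fin K} {a b : Fin K}
    (h : (Fin.snoc I a : Fin (T + 1) → Fin K) = Fin.snoc J b) : I = J ∧ a = b := by
  refine ⟨?_, ?_⟩
  · simpa only [Fin.init_snoc] using congrArg (fun f : Fin (T + 1) → Fin K => Fin.init f) h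
  · simpa only [Fin.snoc_last] using congrFun h (Fin.last T)

theorem law_succ {K : ℕ} (Λ : Algorithm K) (adv : Adversary K) (T : ℕ) (I : Fin T → Fin K)
    (a : Fin K) :
    law Λ adv (T + 1) (Fin.snoc I a : Fin (T + 1) → Fin K) =
      law Λ adv T I * Λ (history adv T I) a := by
  classical
  simp only [law, PMF.bind_apply, PMF.map_apply]
  rw [tsum_eq_single I, tsum_eq_single a]
  · simp
  · intro b hb
    rw [if_neg fun h => hb (snoc_injective h).2.symm]
  · intro J hJ
    rw [ENNReal.tsum_eq_zero.2, mul_zero]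
    intro b
    rw [if_neg fun h => hJ (snoc_injective h).1.symm]

theorem history_snoc {K : ℕ} (adv : Adversary K) (T : ℕ) (I : Fin T → Fin K) (a : Fin K) :
    history adv (T + 1) (Fin.snoc I a : Fin (T + 1) → Fin K) =
      (a, adv T (Fin.snoc I a : Fin (T + 1) → Fin K)) :: history adv T I := by
  simp [history]

theorem length_history {K : ℕ} (adv : Adversary K) (T : ℕ) (I : Fin T → Fin K) :
    (history adv T I).length = T := by
  induction T with
  | zero => rfl
  | succ T ih => simp [history, ih]

theorem history_congr_adversary {K : ℕ} {adv adv' : Adversary K} {T : ℕ}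
    (h : ∀ t < T, adv t = adv' t) (I : Fin T → Fin K) : history adv T I = history adv' T I := by
  induction T with
  | zero => rfl
  | succ T ih =>
    simp only [history, h T (Nat.lt_succ_self T),
      ih (fun s hs => h s (hs.trans (Nat.lt_succ_self T)))]

theorem sum_pmf_toReal {α : Type*} [Fintype α] (p : PMF α) : ∑ a, (p a).toReal = 1 := by
  rw [← ENNReal.toReal_sum fun a _ => p.apply_ne_top a, ← tsum_fintype (L := .unconditional α),
    p.tsum_coe, ENNReal.toReal_one]

theorem law_zero_toReal {K : ℕ} (Λ : Algorithm K) (adv : Adversary K) (I : Fin 0 → Fin K) :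
    (law Λ adv 0 I).toReal = 1 := by
  have h : I = Fin.elim0 := Subsingleton.elim _ _
  simp [law, h]

theorem sum_law_succ {K : ℕ} (Λ : Algorithm K) (adv : Adversary K) (T : ℕ)
    (F : (Fin (T + 1) → Fin K) → ℝ) :
    ∑ J, (law Λ adv (T + 1) J).toReal * F J =
      ∑ I, (law Λ adv T I).toReal * ∑ a, (Λ (history adv T I) a).toReal *
        F (Fin.snoc I a : Fin (T + 1) → Fin K) := by
  rw [sum_snoc]
  refine Finset.sum_congr rfl fun I _ => ?_
  rw [Finset.mul_sum]
  refine Finset.sum_congr rfl fun a _ => ?_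
  rw [law_succ, ENNReal.toReal_mul, mul_assoc]

/-! ### Composition of private mechanisms -/

/-- Hoeffding-type bound for one step: the `s`-th moment of the likelihood ratio. -/
theorem sum_mul_ratio_rpow_le {α : Type*} [Fintype α] {p p' : α → ℝ} (hp' : ∀ a, 0 ≤ p' a)
    (hs : ∑ a, p a = 1) (hs' : ∑ a, p' a = 1) {b : ℝ} (hb : 0 ≤ b)
    (h1 : ∀ a, p a ≤ Real.exp b * p' a) (h2 : ∀ a, p' a ≤ Real.exp b * p a) {s : ℝ}
    (hs0 : 0 < s) :
    ∑ a, p' a * (p a / p' a) ^ s ≤ Real.exp (s ^ 2 / 2 * b ^ 2) := by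
  have hpos : ∀ a, 0 < p' a → 0 < p a := fun a ha => by
    have := h2 a
    by_contra hn
    nlinarith [Real.exp_pos b]
  have hzero : ∀ a, p' a = 0 → p a = 0 := fun a ha => by
    have h3 := h1 a
    have h4 := h2 a
    rw [ha] at h3 h4
    have := Real.exp_pos b
    nlinarith
  rcases hb.eq_or_lt with rfl | hb
  · have hpp : ∀ a, p a = p' a := fun a => by
      have h3 := h1 a
      have h4 := h2 a
      simp only [Real.exp_zero, one_mul] at h3 h4
      exact le_antisymm h3 h4
    have : ∀ a, p' a * (p a / p' a) ^ s = p' a := fun a => by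
      rcases eq_or_ne (p' a) 0 with h | h
      · simp [h]
      · rw [hpp, div_self h, Real.one_rpow, mul_one]
    simp [this, hs']
  -- With l = ln(p/p') in [-b, b], the chord of the exponential on [-sb, sb] bounds exp(sl) by an
  -- affine function of l. Replacing l by p/p' - 1, which has mean zero under p', leaves only
  -- cosh(sb).
  have key : ∀ a, p' a * (p a / p' a) ^ s ≤
      p' a * Real.cosh (s * b) + Real.sinh (s * b) / b * (p a - p' a) := by
    intro a
    rcases (hp' a).eq_or_lt with h | h
    · simp [← h, hzero a h.symm]
    have hpa := hpos a h
    set l := Real.log (p a / p' a) with hl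
    have hr : 0 < p a / p' a := div_pos hpa h
    have hlu : l ≤ b := by
      rw [hl, Real.log_le_iff_le_exp hr, div_le_iff₀ h]
      exact h1 a
    have hll : -b ≤ l := by
      rw [hl, Real.le_log_iff_exp_le hr, le_div_iff₀ h, Real.exp_neg,
        inv_mul_le_iff₀ (Real.exp_pos b)]
      exact h2 a
    have hconv := convexOn_exp.2 (Set.mem_univ (-(s * b))) (Set.mem_univ (s * b))
      (show 0 ≤ (b - l) / (2 * b) from div_nonneg (by linarith) (by linarith))
      (show 0 ≤ (b + l) / (2 * b) from div_nonneg (by linarith) (by linarith))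
      (by field_simp; ring)
    have harg : (b - l) / (2 * b) * -(s * b) + (b + l) / (2 * b) * (s * b) = l * s := by
      field_simp; ring
    simp only [smul_eq_mul] at hconv
    rw [harg] at hconv
    have hle : Real.exp (l * s) ≤ Real.cosh (s * b) + Real.sinh (s * b) / b * l := by
      refine hconv.trans (le_of_eq ?_)
      rw [Real.cosh_eq, Real.sinh_eq]
      field_simp
      ring
    have hl1 : l ≤ p a / p' a - 1 := Real.log_le_sub_one_of_pos hr
    have hsinh : 0 ≤ Real.sinh (s * b) / b :=
      div_nonneg (Real.sinh_nonneg_iff.2 (by positivity)) hb.le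
    rw [Real.rpow_def_of_pos hr]
    calc p' a * Real.exp (l * s)
        ≤ p' a * (Real.cosh (s * b) + Real.sinh (s * b) / b * (p a / p' a - 1)) := by
          gcongr
          exact hle.trans (by gcongr)
      _ = _ := by field_simp
  calc ∑ a, p' a * (p a / p' a) ^ s
      ≤ ∑ a, (p' a * Real.cosh (s * b) + Real.sinh (s * b) / b * (p a - p' a)) :=
        Finset.sum_le_sum fun a _ => key a
    _ = Real.cosh (s * b) := by
        rw [Finset.sum_add_distrib, ← Finset.sum_mul, ← Finset.mul_sum, Finset.sum_sub_distrib,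
          hs, hs']
        ring
    _ ≤ Real.exp ((s * b) ^ 2 / 2) := Real.cosh_le_exp_half_sq _
    _ = _ := by ring_nf

/-- The likelihood ratio of a sequence of arms is a product of conditional ratios given the same
past arms, so the one-step moment bounds multiply. -/
theorem sum_law_ratio_rpow_le {K : ℕ} {Λ : Algorithm K} {adv adv' : Adversary K} {b : ℕ → ℝ}
    (hb : ∀ t, 0 ≤ b t)
    (h1 : ∀ t I a, (Λ (history adv t I) a).toReal ≤
      Real.exp (b t) * (Λ (history adv' t I) a).toReal)
    (h2 : ∀ t I a, (Λ (history adv' t I) a).toReal ≤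
      Real.exp (b t) * (Λ (history adv t I) a).toReal) {s : ℝ} (hs : 0 < s) (T : ℕ) :
    ∑ I, (law Λ adv' T I).toReal * ((law Λ adv T I).toReal / (law Λ adv' T I).toReal) ^ s ≤
      Real.exp (s ^ 2 / 2 * ∑ t ∈ Finset.range T, b t ^ 2) := by
  induction T with
  | zero => simp [law_zero_toReal]
  | succ T ih =>
    rw [sum_law_succ]
    calc _ = ∑ I, (law Λ adv' T I).toReal *
          ((law Λ adv T I).toReal / (law Λ adv' T I).toReal) ^ s *
          ∑ a, (Λ (history adv' T I) a).toReal *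
            ((Λ (history adv T I) a).toReal / (Λ (history adv' T I) a).toReal) ^ s := by
          refine Finset.sum_congr rfl fun I _ => ?_
          rw [mul_assoc]
          congr 1
          rw [Finset.mul_sum]
          refine Finset.sum_congr rfl fun a _ => ?_
          rw [law_succ, law_succ, ENNReal.toReal_mul, ENNReal.toReal_mul, mul_div_mul_comm,
            Real.mul_rpow (by positivity) (by positivity)]
          ring
      _ ≤ ∑ I, (law Λ adv' T I).toReal *
          ((law Λ adv T I).toReal / (law Λ adv' T I).toReal) ^ s *
          Real.exp (s ^ 2 / 2 * b T ^ 2) := by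
          gcongr with I
          exact sum_mul_ratio_rpow_le (fun _ => ENNReal.toReal_nonneg) (sum_pmf_toReal _)
            (sum_pmf_toReal _) (hb T) (h1 T I) (h2 T I) hs
      _ ≤ _ := by
          rw [← Finset.sum_mul, Finset.sum_range_succ, mul_add, Real.exp_add]
          gcongr

/-- Absolute continuity: the convention x / 0 = 0 in the likelihood ratio loses no mass. -/
theorem law_eq_zero_of_law_eq_zero {K : ℕ} {Λ : Algorithm K} {adv adv' : Adversary K} {b : ℕ → ℝ}
    (h1 : ∀ t I a, (Λ (history adv t I) a).toReal ≤
      Real.exp (b t) * (Λ (history adv' t I) a).toReal) (T : ℕ) (I : Fin T → Fin K)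
    (h : (law Λ adv' T I).toReal = 0) : (law Λ adv T I).toReal = 0 := by
  induction T with
  | zero => simp [law_zero_toReal] at h
  | succ T ih =>
    rw [← Fin.snoc_init_self I] at h ⊢
    rw [law_succ, ENNReal.toReal_mul, mul_eq_zero] at h ⊢
    refine h.imp (ih _) fun h => ?_
    have := h1 T (Fin.init I) (I (Fin.last T))
    rw [h, mul_zero] at this
    exact le_antisymm this ENNReal.toReal_nonneg

/-- Adaptive composition: if the log-likelihood ratio of round `t` is at most `b t`, then the
probability of an event changes by a factor `exp ε` at most, up to `δ`. -/
theorem toOuterMeasure_law_le {K : ℕ} {Λ : Algorithm K} {adv adv' : Adversary K} {b : ℕ → ℝ}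
    (hb : ∀ t, 0 ≤ b t)
    (h1 : ∀ t I a, (Λ (history adv t I) a).toReal ≤
      Real.exp (b t) * (Λ (history adv' t I) a).toReal)
    (h2 : ∀ t I a, (Λ (history adv' t I) a).toReal ≤
      Real.exp (b t) * (Λ (history adv t I) a).toReal) {s : ℝ} (hs : 1 ≤ s) {T : ℕ} {ε δ : ℝ}
    (hδ : Real.exp (s ^ 2 / 2 * ∑ t ∈ Finset.range T, b t ^ 2 - (s - 1) * ε) ≤ δ)
    (S : Set (Fin T → Fin K)) :
    (law Λ adv T).toOuterMeasure S ≤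
      ENNReal.ofReal δ + (law Λ adv' T).toOuterMeasure S * ENNReal.ofReal (Real.exp ε) := by
  classical
  set P := fun I => (law Λ adv T I).toReal
  set P' := fun I => (law Λ adv' T I).toReal
  have hS : ∀ a : Adversary K, (law Λ a T).toOuterMeasure S =
      ENNReal.ofReal (∑ I, S.indicator (fun I => (law Λ a T I).toReal) I) := by
    intro a
    rw [PMF.toOuterMeasure_apply, tsum_fintype,
      ENNReal.ofReal_sum_of_nonneg fun I _ => Set.indicator_nonneg
        (fun _ _ => ENNReal.toReal_nonneg) I]
    refine Finset.sum_congr rfl fun I _ => ?_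
    by_cases hI : I ∈ S
    · simp [hI, ENNReal.ofReal_toReal, PMF.apply_ne_top]
    · simp [hI]
  have hδ0 : 0 ≤ δ := (Real.exp_pos _).le.trans hδ
  have hnn : 0 ≤ ∑ I, S.indicator P' I :=
    Finset.sum_nonneg fun I _ => Set.indicator_nonneg (fun _ _ => ENNReal.toReal_nonneg) I
  rw [hS, hS, ← ENNReal.ofReal_mul hnn, ← ENNReal.ofReal_add hδ0 (by positivity)]
  refine ENNReal.ofReal_le_ofReal ?_
  -- Pointwise Markov inequality: where P ≤ exp(ε) P' the second term suffices. Elsewhere the ratio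
  -- exceeds exp(ε), and its power s - 1 pays for the factor exp(-(s-1)ε).
  have key : ∀ I, S.indicator P I ≤ Real.exp (-((s - 1) * ε)) * (P' I * (P I / P' I) ^ s) +
      S.indicator P' I * Real.exp ε := by
    intro I
    have hP : 0 ≤ P I := ENNReal.toReal_nonneg
    have hP' : 0 ≤ P' I := ENNReal.toReal_nonneg
    have hA : 0 ≤ Real.exp (-((s - 1) * ε)) * (P' I * (P I / P' I) ^ s) := by positivity
    by_cases hI : I ∈ S
    · simp only [hI, Set.indicator_of_mem]
      rcases le_or_gt (P I) (P' I * Real.exp ε) with h | h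
      · linarith
      · have hP'0 : P' I ≠ 0 := fun h0 => by
          have := law_eq_zero_of_law_eq_zero h1 T I h0
          change P I = 0 at this
          rw [this, h0] at h
          simp at h
        have hP'1 : 0 < P' I := lt_of_le_of_ne hP' hP'0.symm
        have hr : Real.exp ε ≤ P I / P' I := by
          rw [le_div_iff₀ hP'1]; linarith
        have hr0 : 0 < P I / P' I := (Real.exp_pos ε).trans_le hr
        have hpow : Real.exp ((s - 1) * ε) ≤ (P I / P' I) ^ (s - 1) := by
          rw [mul_comm, Real.exp_mul]
          exact Real.rpow_le_rpow (Real.exp_pos _).le hr (by linarith)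
        have : P' I * (P I / P' I) ^ s = P I * (P I / P' I) ^ (s - 1) := by
          have hP0 : P I ≠ 0 := fun h0 => by simp [h0] at hr0
          rw [Real.rpow_sub_one hr0.ne']
          field_simp
        rw [this]
        have h3 : P I ≤ Real.exp (-((s - 1) * ε)) * (P I * (P I / P' I) ^ (s - 1)) := by
          calc P I = Real.exp (-((s - 1) * ε)) * (P I * Real.exp ((s - 1) * ε)) := by
                rw [Real.exp_neg]; field_simp
            _ ≤ _ := by gcongr
        have : 0 ≤ P' I * Real.exp ε := by positivity
        linarith
    · simpa [hI] using hA
  calc ∑ I, S.indicator P I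
      ≤ ∑ I, (Real.exp (-((s - 1) * ε)) * (P' I * (P I / P' I) ^ s) +
          S.indicator P' I * Real.exp ε) := Finset.sum_le_sum fun I _ => key I
    _ = Real.exp (-((s - 1) * ε)) * ∑ I, P' I * (P I / P' I) ^ s +
          (∑ I, S.indicator P' I) * Real.exp ε := by
        rw [Finset.sum_add_distrib, ← Finset.mul_sum, ← Finset.sum_mul]
    _ ≤ δ + (∑ I, S.indicator P' I) * Real.exp ε := by
        gcongr
        refine le_trans ?_ hδ
        rw [sub_eq_neg_add _ ((s - 1) * ε), Real.exp_add]
        gcongr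
        exact sum_law_ratio_rpow_le hb h1 h2 (by linarith) T

/-! ### Adjacent histories -/

/-- Two histories with the same arms whose gains differ in one entry, by `d` at most. -/
inductive Adjacent {K : ℕ} (d : ℝ) : List (Fin K × ℝ) → List (Fin K × ℝ) → Prop
  | head {a : Fin K} {x x' : ℝ} {h : List (Fin K × ℝ)} (hx : |x - x'| ≤ d) :
      Adjacent d ((a, x) :: h) ((a, x') :: h)
  | cons {p : Fin K × ℝ} {h h' : List (Fin K × ℝ)} (hh : Adjacent d h h') :
      Adjacent d (p :: h) (p :: h')

theorem Adjacent.symm {K : ℕ} {d : ℝ} {h h' : List (Fin K × ℝ)} (H : Adjacent d h h') :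
    Adjacent d h' h := by
  induction H with
  | head hx => exact .head (by rwa [abs_sub_comm])
  | cons _ ih => exact .cons ih

theorem Adjacent.length_eq {K : ℕ} {d : ℝ} {h h' : List (Fin K × ℝ)} (H : Adjacent d h h') :
    h.length = h'.length := by
  induction H with
  | head hx => rfl
  | cons _ ih => simp [ih]

/-- The changed entry lies either beyond the first k entries or among them; this locates it relative
to a block. -/
theorem Adjacent.split {K : ℕ} {d : ℝ} {h h' : List (Fin K × ℝ)} (H : Adjacent d h h') (k : ℕ) :
    (h.take k = h'.take k ∧ Adjacent d (h.drop k) (h'.drop k)) ∨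
      (h.drop k = h'.drop k ∧ (h.take k).map Prod.fst = (h'.take k).map Prod.fst ∧
        |((h.take k).map Prod.snd).sum - ((h'.take k).map Prod.snd).sum| ≤ d) := by
  induction H generalizing k with
  | head hx =>
    cases k with
    | zero => exact .inl ⟨rfl, .head hx⟩
    | succ k => exact .inr (by simpa using hx)
  | cons hh ih =>
    cases k with
    | zero => exact .inl ⟨rfl, .cons hh⟩
    | succ k => simpa using ih k

theorem history_eq_or_adjacent {K : ℕ} {g g' : ℕ → Fin K → ℝ}
    (hg : ∀ t i, g t i ∈ Set.Icc (0 : ℝ) 1) (hg' : ∀ t i, g' t i ∈ Set.Icc (0 : ℝ) 1) {s : ℕ}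
    (hs : ∀ t, t ≠ s → g t = g' t) (t : ℕ) (I : Fin t → Fin K) :
    history (oblivious g) t I = history (oblivious g') t I ∨
      Adjacent 1 (history (oblivious g) t I) (history (oblivious g') t I) := by
  induction t with
  | zero => exact .inl rfl
  | succ t ih =>
    rcases eq_or_ne t s with rfl | ht
    · right
      have hadv : ∀ r < t, oblivious g r = oblivious g' r := fun r hr => by
        funext J
        simp only [oblivious, hs r hr.ne]
      simp only [history, history_congr_adversary hadv]
      refine .head ?_
      have h1 := hg t (I (Fin.last t))
      have h2 := hg' t (I (Fin.last t))
      rw [abs_le]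
      exact ⟨by simp only [oblivious]; linarith [h1.1, h2.2], by
        simp only [oblivious]; linarith [h1.2, h2.1]⟩
    · simp only [history, oblivious, hs t ht]
      exact (ih (Fin.init I)).imp (fun h => congrArg _ h) fun h => .cons h

theorem mem_history {K : ℕ} {adv : Adversary K}
    (hadv : ∀ t I, adv t I ∈ Set.Icc (0 : ℝ) 1) (t : ℕ) (I : Fin t → Fin K) :
    ∀ p ∈ history adv t I, p.2 ∈ Set.Icc (0 : ℝ) 1 := by
  induction t with
  | zero => simp [history]
  | succ t ih =>
    intro p hp
    rcases List.mem_cons.1 hp with rfl | hp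
    · exact hadv _ _
    · exact ih _ p hp

/-! ### Histories of blocks -/

theorem blockHistory_of_length_lt {K : ℕ} [NeZero K] {τ : ℕ} {h : List (Fin K × ℝ)}
    (hh : h.length < τ) : blockHistory τ h = [] := by
  simp [blockHistory, Nat.div_eq_of_lt hh]

theorem blockHistory_of_le_length {K : ℕ} [NeZero K] {τ : ℕ} (hτ : 0 < τ)
    {h : List (Fin K × ℝ)} (hh : τ ≤ h.length) :
    blockHistory τ h = ((((h.take τ).map Prod.fst).headD 0),
      ((h.take τ).map Prod.snd).sum / τ) :: blockHistory τ (h.drop τ) := by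
  have h1 : h.length / τ = (h.drop τ).length / τ + 1 := by
    rw [List.length_drop, Nat.div_eq_sub_div hτ hh]
  unfold blockHistory
  rw [h1, List.range_succ_eq_map, List.map_cons, List.map_map]
  congr 1
  · simp
  · refine List.map_congr_left fun j _ => ?_
    simp only [Function.comp, List.drop_drop]
    rw [show (j.succ * τ) = τ + j * τ by rw [Nat.succ_mul, add_comm]]

/-- One changed gain moves one block sum by at most 1, hence that average by at most 1/τ. Blocks are
cut from the recent end, so a length divisible by τ ensures that the change is not in a discarded
remainder. -/
theorem blockHistory_adjacent {K : ℕ} [NeZero K] {τ : ℕ} (hτ : 0 < τ)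
    (m : ℕ) {h h' : List (Fin K × ℝ)} (hm : h.length = m * τ) (H : Adjacent 1 h h') :
    Adjacent (1 / τ) (blockHistory τ h) (blockHistory τ h') := by
  induction m generalizing h h' with
  | zero => cases H <;> simp at hm
  | succ m ih =>
    have hl : τ ≤ h.length := by rw [hm]; nlinarith
    have hl' : τ ≤ h'.length := by rwa [← H.length_eq]
    rw [blockHistory_of_le_length hτ hl, blockHistory_of_le_length hτ hl']
    rcases H.split τ with ⟨h1, h2⟩ | ⟨h1, h2, h3⟩
    · rw [h1]
      exact .cons (ih (by rw [List.length_drop, hm, Nat.succ_mul, Nat.add_sub_cancel]) h2)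
    · rw [h1, h2]
      refine .head ?_
      rw [← sub_div, abs_div, Nat.abs_cast]
      gcongr

theorem mem_blockHistory {K : ℕ} [NeZero K] {τ : ℕ} {h : List (Fin K × ℝ)}
    (hh : ∀ p ∈ h, p.2 ∈ Set.Icc (0 : ℝ) 1) :
    ∀ p ∈ blockHistory τ h, p.2 ∈ Set.Icc (0 : ℝ) 1 := by
  intro p hp
  obtain ⟨j, -, rfl⟩ := List.mem_map.1 hp
  have hB : ∀ x ∈ (((h.drop (j * τ)).take τ).map Prod.snd), x ∈ Set.Icc (0 : ℝ) 1 := by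
    intro x hx
    obtain ⟨q, hq, rfl⟩ := List.mem_map.1 hx
    exact hh q (List.mem_of_mem_drop (List.mem_of_mem_take hq))
  refine ⟨div_nonneg (List.sum_nonneg fun x hx => (hB x hx).1) (Nat.cast_nonneg _),
    div_le_one_of_le₀ ?_ (Nat.cast_nonneg _)⟩
  refine (List.sum_le_card_nsmul _ 1 fun x hx => (hB x hx).2).trans ?_
  rw [nsmul_one, List.length_map, Nat.cast_le]
  exact List.length_take_le _ _

/-! ### Privacy of EXP3 -/

/-- The weights of two soft-max distributions compare to their exponents. -/
theorem exp_div_sum_le {K : ℕ} [NeZero K] {u v : Fin K → ℝ} {lo : ℝ}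
    (h : ∀ i, lo ≤ u i - v i) (i : Fin K) :
    Real.exp (u i) / ∑ j, Real.exp (u j) ≤
      Real.exp (u i - v i - lo) * (Real.exp (v i) / ∑ j, Real.exp (v j)) := by
  have hS : 0 < ∑ j, Real.exp (v j) :=
    Finset.sum_pos (fun j _ => Real.exp_pos _) Finset.univ_nonempty
  have hS' : 0 < ∑ j, Real.exp (u j) :=
    Finset.sum_pos (fun j _ => Real.exp_pos _) Finset.univ_nonempty
  have hle : Real.exp lo * ∑ j, Real.exp (v j) ≤ ∑ j, Real.exp (u j) := by
    rw [Finset.mul_sum]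
    refine Finset.sum_le_sum fun j _ => ?_
    rw [← Real.exp_add]
    exact Real.exp_le_exp.2 (by linarith [h j])
  rw [← mul_div_assoc, ← Real.exp_add, show u i - v i - lo + v i = u i - lo by ring, Real.exp_sub,
    div_div]
  gcongr

/-- A common shift of the exponents cancels in the soft-max, so only the oscillation hi - lo counts;
the uniform part is harmless because the factor is at least 1. -/
theorem exp3Prob_le {K : ℕ} [NeZero K] {γ : ℝ} (h0 : 0 ≤ γ) (h1 : γ ≤ 1) {G G' : Fin K → ℝ}
    {lo hi : ℝ} (hlo : ∀ i, lo ≤ γ / K * (G i - G' i)) (hhi : ∀ i, γ / K * (G i - G' i) ≤ hi)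
    (i : Fin K) : exp3Prob γ G i ≤ Real.exp (hi - lo) * exp3Prob γ G' i := by
  have hd : 1 ≤ Real.exp (hi - lo) := Real.one_le_exp (by linarith [hlo i, hhi i])
  have h := exp_div_sum_le (u := fun i => γ / K * G i) (v := fun i => γ / K * G' i) (lo := lo)
    (fun i => by have := hlo i; linarith) i
  have h2 : Real.exp (γ / K * G i) / ∑ j, Real.exp (γ / K * G j) ≤
      Real.exp (hi - lo) * (Real.exp (γ / K * G' i) / ∑ j, Real.exp (γ / K * G' j)) := by
    refine h.trans ?_
    gcongr
    have := hhi i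
    linarith
  unfold exp3Prob
  rw [mul_add]
  have h3 : (γ / K : ℝ) ≤ Real.exp (hi - lo) * (γ / K) := le_mul_of_one_le_left (by positivity) hd
  have h4 : 0 ≤ 1 - γ := by linarith
  calc _ ≤ (1 - γ) * (Real.exp (hi - lo) *
        (Real.exp (γ / K * G' i) / ∑ j, Real.exp (γ / K * G' j))) +
        Real.exp (hi - lo) * (γ / K) := by gcongr
    _ = _ := by ring

theorem exp3_apply_toReal {K : ℕ} [NeZero K] (γ : unitInterval) (h : List (Fin K × ℝ))
    (i : Fin K) : (exp3 γ h i).toReal = exp3Prob γ (exp3Estimate γ h) i := by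
  rw [exp3, PMF.ofFintype_apply, ENNReal.toReal_ofReal (exp3Prob_nonneg γ.2.1 γ.2.2 _ i)]

theorem div_exp3Prob_le_one {K : ℕ} {γ : ℝ} (h0 : 0 ≤ γ) (h1 : γ ≤ 1)
    (G : Fin K → ℝ) (i : Fin K) : γ / K / exp3Prob γ G i ≤ 1 := by
  refine div_le_one_of_le₀ ?_ (exp3Prob_nonneg h0 h1 G i)
  have : 0 ≤ 1 - γ := by linarith
  exact le_add_of_nonneg_left (by positivity)

/-- The importance-weighted increments contract the difference of two estimates. -/
theorem div_exp3Prob_sub_le {K : ℕ} [NeZero K] {γ : ℝ} (h0 : 0 ≤ γ) (h1 : γ ≤ 1)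
    {G G' : Fin K → ℝ} {lo : ℝ} (hlo : ∀ i, lo ≤ γ / K * (G i - G' i)) (i : Fin K) :
    γ / K / exp3Prob γ G' i - γ / K / exp3Prob γ G i ≤ γ / K * (G i - G' i) - lo := by
  set w := γ / K * (G i - G' i) - lo with hw
  have hw0 : 0 ≤ w := by linarith [hlo i]
  have hη : 0 ≤ γ / K := by positivity
  rcases hη.eq_or_lt with hη | hη
  · simpa [← hη] using hw0
  have hg : 0 ≤ 1 - γ := by linarith
  have h := exp_div_sum_le (u := fun i => γ / K * G i) (v := fun i => γ / K * G' i) (lo := lo)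
    (fun i => by have := hlo i; linarith) i
  simp only [← mul_sub] at h
  rw [← hw] at h
  have hdef : ∀ F : Fin K → ℝ, exp3Prob γ F i =
    (1 - γ) * (Real.exp (γ / K * F i) / ∑ j, Real.exp (γ / K * F j)) + γ / K := fun F => rfl
  rw [hdef, hdef]
  set q := Real.exp (γ / K * G i) / ∑ j, Real.exp (γ / K * G j) with hq
  set q' := Real.exp (γ / K * G' i) / ∑ j, Real.exp (γ / K * G' j) with hq'
  have hq0 : 0 ≤ q := by positivity
  have hq'0 : 0 ≤ q' := by positivity
  set η := γ / K
  have hp : 0 < (1 - γ) * q + η := by positivity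
  have hp' : 0 < (1 - γ) * q' + η := by positivity
  -- From q ≤ exp(w) q' and 1 - w ≤ exp(-w). This yields p - p' ≤ w p for the mixed probabilities,
  -- so η/p' - η/p = η(p - p')/(p p') ≤ wη/p' ≤ w.
  have hqw : q * (1 - w) ≤ q' := by
    have : 1 - w ≤ Real.exp (-w) := by linarith [Real.add_one_le_exp (-w)]
    calc q * (1 - w) ≤ q * Real.exp (-w) := by gcongr
      _ ≤ Real.exp w * q' * Real.exp (-w) := by gcongr
      _ = q' := by rw [Real.exp_neg]; field_simp
  rw [div_sub_div _ _ hp'.ne' hp.ne', div_le_iff₀ (by positivity)]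
  have h5 : (1 - γ) * (q - q') ≤ w * ((1 - γ) * q + η) := by
    have : (1 - γ) * (q * (1 - w)) ≤ (1 - γ) * q' := by gcongr
    nlinarith [mul_nonneg hw0 hη.le]
  have h6 : η * ((1 - γ) * (q - q')) ≤ ((1 - γ) * q' + η) * (w * ((1 - γ) * q + η)) := by
    calc η * ((1 - γ) * (q - q')) ≤ η * (w * ((1 - γ) * q + η)) := by gcongr
      _ ≤ _ := by
        gcongr
        exact le_add_of_nonneg_left (by positivity)
  linarith

/-- Induction from the changed round to the present: the interval [lo, hi] is fixed when the change
occurs, and later rounds keep every scaled difference inside it. -/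
theorem exp3Estimate_adjacent {K : ℕ} [NeZero K] {γ d : ℝ} (h0 : 0 ≤ γ) (h1 : γ ≤ 1)
    {h h' : List (Fin K × ℝ)} (H : Adjacent d h h')
    (hh : ∀ p ∈ h, p.2 ∈ Set.Icc (0 : ℝ) 1) :
    ∃ lo hi : ℝ, hi - lo ≤ d ∧ ∀ i,
      lo ≤ γ / K * (exp3Estimate γ h i - exp3Estimate γ h' i) ∧
      γ / K * (exp3Estimate γ h i - exp3Estimate γ h' i) ≤ hi := by
  have hη : 0 ≤ γ / K := by positivity
  induction H with
  | @head a x x' h hx =>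
    set D := γ / K * (x - x') / exp3Prob γ (exp3Estimate γ h) a with hD
    have hDd : |D| ≤ d := by
      rw [hD, mul_div_right_comm, abs_mul,
        abs_of_nonneg (div_nonneg hη (exp3Prob_nonneg h0 h1 _ _))]
      exact (mul_le_of_le_one_left (abs_nonneg _) (div_exp3Prob_le_one h0 h1 _ _)).trans hx
    refine ⟨min 0 D, max 0 D, ?_, fun i => ?_⟩
    · rw [max_sub_min_eq_abs']
      simpa using hDd
    · have : γ / K * (exp3Estimate γ ((a, x) :: h) i - exp3Estimate γ ((a, x') :: h) i) =
          if i = a then D else 0 := by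
        simp only [exp3Estimate]
        split_ifs with hi
        · subst hi; rw [hD]; ring
        · ring
      rw [this]
      split_ifs <;> simp
  | @cons p h h' _ ih =>
    obtain ⟨lo, hi, hlh, hI⟩ := ih fun q hq => hh q (List.mem_cons_of_mem _ hq)
    refine ⟨lo, hi, hlh, fun i => ?_⟩
    obtain ⟨a, x⟩ := p
    have hx := hh (a, x) List.mem_cons_self
    simp only [exp3Estimate]
    split_ifs with hia
    · have e1 := div_exp3Prob_sub_le h0 h1 (fun i => (hI i).1) i
      have e2 := div_exp3Prob_sub_le h0 h1 (G := exp3Estimate γ h') (G' := exp3Estimate γ h)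
        (lo := -hi) (fun i => by have := (hI i).2; linarith) i
      obtain ⟨hl, hu⟩ := hI i
      set P := exp3Prob γ (exp3Estimate γ h) i
      set P' := exp3Prob γ (exp3Estimate γ h') i
      set G := exp3Estimate γ h i
      set G' := exp3Estimate γ h' i
      have e : γ / K * (G + x / P - (G' + x / P')) =
          γ / K * (G - G') + x * (γ / K / P - γ / K / P') := by ring
      rw [e]
      obtain ⟨hx0, hx1⟩ := hx
      simp only at hx0 hx1
      constructor <;> nlinarith
    · simpa using hI i

theorem exp3_le_of_adjacent {K : ℕ} [NeZero K] (γ : unitInterval) {d : ℝ}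
    {h h' : List (Fin K × ℝ)} (H : Adjacent d h h')
    (hh : ∀ p ∈ h, p.2 ∈ Set.Icc (0 : ℝ) 1) (a : Fin K) :
    (exp3 γ h a).toReal ≤ Real.exp d * (exp3 γ h' a).toReal := by
  obtain ⟨lo, hi, hlh, hI⟩ := exp3Estimate_adjacent γ.2.1 γ.2.2 H hh
  rw [exp3_apply_toReal, exp3_apply_toReal]
  refine (exp3Prob_le γ.2.1 γ.2.2 (fun i => (hI i).1) (fun i => (hI i).2) a).trans ?_
  have := exp3Prob_nonneg γ.2.1 γ.2.2 (exp3Estimate γ h') a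
  gcongr

/-! ### Privacy of EXP3 in blocks -/

/-- Inside a block the previous arm is repeated with certainty, and the first draw sees no gains.
Privacy is lost only at later block starts. -/
theorem miniBatch_le {K : ℕ} [NeZero K] {τ : ℕ} (hτ : 0 < τ) (γ : unitInterval)
    {h h' : List (Fin K × ℝ)} (H : h = h' ∨ Adjacent 1 h h')
    (hh : ∀ p ∈ h, p.2 ∈ Set.Icc (0 : ℝ) 1) (a : Fin K) :
    (miniBatch τ (exp3 γ) h a).toReal ≤
      Real.exp (if h.length ≠ 0 ∧ τ ∣ h.length then 1 / τ else 0) *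
        (miniBatch τ (exp3 γ) h' a).toReal := by
  rcases H with rfl | H
  · refine le_mul_of_one_le_left ENNReal.toReal_nonneg (Real.one_le_exp ?_)
    split_ifs <;> positivity
  have key : τ ∣ h.length → (exp3 γ (blockHistory τ h) a).toReal ≤
      Real.exp (1 / τ) * (exp3 γ (blockHistory τ h') a).toReal := by
    rintro ⟨m, hm⟩
    exact exp3_le_of_adjacent γ
      (blockHistory_adjacent hτ m (by rw [hm, mul_comm]) H) (mem_blockHistory hh) a
  have hlen := H.length_eq
  cases H with
  | @head b x x' h hx =>
    simp only [List.length_cons] at key ⊢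
    simp only [miniBatch, ne_eq, Nat.succ_ne_zero, not_false_eq_true, true_and]
    split_ifs with hd
    · exact key hd
    · simp
  | @cons p h h' hh' =>
    simp only [List.length_cons] at key hlen ⊢
    simp only [miniBatch, ne_eq, Nat.succ_ne_zero, not_false_eq_true, true_and]
    rw [← hlen]
    split_ifs with hd
    · exact key hd
    · simp

theorem sum_range_block_le {τ : ℕ} (hτ : 0 < τ) (T : ℕ) :
    ∑ t ∈ Finset.range T, (if t ≠ 0 ∧ τ ∣ t then 1 / (τ : ℝ) else 0) ^ 2 ≤ T / τ ^ 3 := by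
  have h : ∀ t, (if t ≠ 0 ∧ τ ∣ t then 1 / (τ : ℝ) else 0) ^ 2 =
      if t ≠ 0 ∧ τ ∣ t then 1 / (τ : ℝ) ^ 2 else 0 := fun t => by split_ifs <;> simp
  simp only [h]
  rw [← Finset.sum_filter, Finset.sum_const, nsmul_eq_mul]
  have hc : (Finset.filter (fun t => t ≠ 0 ∧ τ ∣ t) (Finset.range T)).card ≤ T / τ := by
    rw [← Nat.card_multiples' T τ]
    refine Finset.card_le_card fun t ht => ?_
    simp only [Finset.mem_filter, Finset.mem_range] at ht ⊢
    exact ⟨by omega, ht.2⟩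
  calc _ ≤ ((T / τ : ℕ) : ℝ) * (1 / (τ : ℝ) ^ 2) := by gcongr
    _ ≤ (T / τ : ℝ) * (1 / (τ : ℝ) ^ 2) := by gcongr; exact Nat.cast_div_le
    _ = _ := by field_simp

theorem log_one_div_pos {δ : ℝ} (hδ : 0 < δ) (hδ1 : δ < 1) : 0 < Real.log (1 / δ) :=
  Real.log_pos (by rw [one_div]; exact (one_lt_inv₀ hδ).2 hδ1)

theorem isDifferentiallyPrivate_exp3Tau {K T : ℕ} [NeZero K] {τ : ℕ} (hτ : 0 < τ) {ε δ : ℝ}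
    (hε : 0 < ε) (hδ : 0 < δ) (hδ1 : δ < 1)
    (h : (4 * T * ε + 2 * T * Real.log (1 / δ)) / ε ^ 2 ≤ (τ : ℝ) ^ 3) :
    IsDifferentiallyPrivate (exp3Tau K T τ) T ε δ := by
  rintro g g' hg hg' ⟨r, hr⟩ S
  have hL : 0 < Real.log (1 / δ) := log_one_div_pos hδ hδ1
  have hδL : δ = Real.exp (-Real.log (1 / δ)) := by
    rw [one_div, Real.log_inv, neg_neg, Real.exp_log hδ]
  set L := Real.log (1 / δ)
  have ho : ∀ {g : ℕ → Fin K → ℝ}, (∀ t i, g t i ∈ Set.Icc (0 : ℝ) 1) →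
      ∀ t I, oblivious g t I ∈ Set.Icc (0 : ℝ) 1 := fun hg t I => hg _ _
  have hE := history_eq_or_adjacent hg hg' hr
  -- The exponent s = 4 + 2L/ε is ε/v for v = ε²/(4ε + 2L), the minimizer of s²v/2 - (s-1)ε. The
  -- hypothesis on τ says that T/τ³ ≤ v, and the minimum is -L - ε.
  refine toOuterMeasure_law_le (b := fun t => if t ≠ 0 ∧ τ ∣ t then 1 / (τ : ℝ) else 0)
    (fun t => by positivity) (fun t I a => ?_) (fun t I a => ?_) (s := 4 + 2 * L / ε) ?_ ?_ S
  · simpa only [length_history, exp3Tau] using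
      miniBatch_le hτ _ (hE t I) (mem_history (ho hg) t I) a
  · simpa only [length_history, exp3Tau] using
      miniBatch_le hτ _ ((hE t I).imp Eq.symm Adjacent.symm)
      (mem_history (ho hg') t I) a
  · have : 0 < 2 * L / ε := by positivity
    linarith
  · rw [hδL, Real.exp_le_exp]
    have hs := sum_range_block_le hτ T
    have hv : (T : ℝ) / τ ^ 3 ≤ ε ^ 2 / (4 * ε + 2 * L) := by
      rw [div_le_iff₀ (by positivity)] at h
      rw [div_le_div_iff₀ (by positivity) (by positivity)]
      linarith
    calc _ ≤ (4 + 2 * L / ε) ^ 2 / 2 * (ε ^ 2 / (4 * ε + 2 * L)) -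
          (4 + 2 * L / ε - 1) * ε := by gcongr; exact hs.trans hv
      _ = (4 * ε + 2 * L) / 2 - (3 * ε + 2 * L) := by field_simp; ring
      _ ≤ -L := by linarith

/-! ### The potential of EXP3 -/

/-- The logarithm of the weight of all arms relative to that of the arm `i`. -/
def exp3Potential {K : ℕ} (γ : ℝ) (i : Fin K) (G : Fin K → ℝ) : ℝ :=
  Real.log (∑ j, Real.exp (γ / K * G j)) - γ / K * G i

theorem exp3Potential_nonneg {K : ℕ} (γ : ℝ) (i : Fin K) (G : Fin K → ℝ) :
    0 ≤ exp3Potential γ i G := by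
  have h : Real.exp (γ / K * G i) ≤ ∑ j, Real.exp (γ / K * G j) :=
    Finset.single_le_sum (f := fun j => Real.exp (γ / K * G j))
      (fun j _ => (Real.exp_pos _).le) (Finset.mem_univ i)
  have := Real.log_le_log (Real.exp_pos _) h
  rw [Real.log_exp] at this
  exact sub_nonneg.2 this

theorem exp3Potential_zero {K : ℕ} (γ : ℝ) (i : Fin K) :
    exp3Potential γ i (fun _ => 0) = Real.log K := by
  simp [exp3Potential]

/-- The potential after adding `y` to the estimate of arm `a`. -/
theorem exp3Potential_update_le {K : ℕ} [NeZero K] {γ : ℝ} (h0 : 0 ≤ γ) (i a : Fin K)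
    (G : Fin K → ℝ) {y : ℝ} (hy : 0 ≤ y) (hy1 : γ / K * y ≤ 1) :
    exp3Potential γ i (fun j => G j + if j = a then y else 0) ≤
      exp3Potential γ i G +
        Real.exp (γ / K * G a) / (∑ j, Real.exp (γ / K * G j)) *
          (γ / K * y + (γ / K * y) ^ 2) -
        if i = a then γ / K * y else 0 := by
  set η := γ / K
  have hη : 0 ≤ η := by positivity
  set S := ∑ j, Real.exp (η * G j) with hS
  have hSpos : 0 < S :=
    Finset.sum_pos (fun j _ => Real.exp_pos _) Finset.univ_nonempty
  have hsum : ∑ j, Real.exp (η * (G j + if j = a then y else 0)) =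
      S + Real.exp (η * G a) * (Real.exp (η * y) - 1) := by
    have : ∀ j, Real.exp (η * (G j + if j = a then y else 0)) =
        Real.exp (η * G j) + if j = a then Real.exp (η * G a) * (Real.exp (η * y) - 1) else 0 := by
      intro j
      split_ifs with h
      · subst h; rw [mul_add, Real.exp_add]; ring
      · simp
    simp only [this, Finset.sum_add_distrib, Finset.sum_ite_eq', Finset.mem_univ, if_true, hS]
  have hy0 : 0 ≤ η * y := by positivity
  have hexp : Real.exp (η * y) - 1 ≤ η * y + (η * y) ^ 2 := by
    have := Real.abs_exp_sub_one_sub_id_le (x := η * y) (by rwa [abs_of_nonneg hy0])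
    linarith [(abs_le.1 this).2]
  have hexp0 : 0 ≤ Real.exp (η * y) - 1 := by linarith [Real.add_one_le_exp (η * y)]
  set q := Real.exp (η * G a) / S with hq
  have hq0 : 0 ≤ q := by positivity
  have hfac : S + Real.exp (η * G a) * (Real.exp (η * y) - 1) =
      S * (1 + q * (Real.exp (η * y) - 1)) := by
    rw [hq]; field_simp
  have hlog : Real.log (S * (1 + q * (Real.exp (η * y) - 1))) ≤
      Real.log S + q * (η * y + (η * y) ^ 2) := by
    have h1 : 0 < 1 + q * (Real.exp (η * y) - 1) := by positivity
    rw [Real.log_mul hSpos.ne' h1.ne']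
    have := Real.log_le_sub_one_of_pos h1
    have : q * (Real.exp (η * y) - 1) ≤ q * (η * y + (η * y) ^ 2) := by gcongr
    linarith
  unfold exp3Potential
  rw [hsum, hfac]
  have hi : η * (G i + if i = a then y else 0) = η * G i + if i = a then η * y else 0 := by
    split_ifs <;> ring
  rw [hi]
  linarith

/-- The expected change of the potential in one round of EXP3 with gains `x`. -/
theorem sum_exp3Prob_mul_potential_le {K : ℕ} [NeZero K] {γ : ℝ} (h0 : 0 < γ) (h1 : γ ≤ 1)
    (G x : Fin K → ℝ) (hx : ∀ a, x a ∈ Set.Icc (0 : ℝ) 1) (i : Fin K) :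
    (1 - γ) * K / γ * ∑ a, exp3Prob γ G a * exp3Potential γ i
        (fun j => G j + if j = a then x a / exp3Prob γ G a else 0) + x i ≤
      (1 - γ) * K / γ * exp3Potential γ i G + ∑ a, exp3Prob γ G a * x a + 2 * γ := by
  have hK : (0 : ℝ) < K := Nat.cast_pos.2 (NeZero.pos K)
  have hη : 0 < γ / K := by positivity
  have hg : 0 ≤ 1 - γ := by linarith
  have hp : ∀ a, γ / K ≤ exp3Prob γ G a := fun a => le_add_of_nonneg_left (by positivity)
  have hp0 : ∀ a, 0 < exp3Prob γ G a := fun a => hη.trans_le (hp a)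
  have hq : ∀ a, (1 - γ) * (Real.exp (γ / K * G a) / ∑ j, Real.exp (γ / K * G j)) ≤
      exp3Prob γ G a := fun a => le_add_of_nonneg_right hη.le
  -- Scaling by (1-γ)/η turns the first-order term (1-γ)q x into at most p x. The second-order term
  -- is at most γ/K per arm by (1-γ)q ≤ p, so γ in total.
  have hstep : ∀ a, (1 - γ) * K / γ * (exp3Prob γ G a * exp3Potential γ i
        (fun j => G j + if j = a then x a / exp3Prob γ G a else 0)) ≤
      (1 - γ) * K / γ * exp3Potential γ i G * exp3Prob γ G a +
        (exp3Prob γ G a * x a + γ / K) - (if i = a then (1 - γ) * x a else 0) := by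
    intro a
    obtain ⟨hx0, hx1⟩ := hx a
    set p := exp3Prob γ G a with hpdef
    have hpa : 0 < p := hp0 a
    have hy1 : γ / K * (x a / p) ≤ 1 := by
      rw [← mul_div_assoc, div_le_one hpa]
      exact (mul_le_of_le_one_right hη.le hx1).trans (hp a)
    have h := exp3Potential_update_le h0.le i a G (y := x a / p) (by positivity) hy1
    set q := Real.exp (γ / K * G a) / ∑ j, Real.exp (γ / K * G j)
    have hqa : (1 - γ) * q ≤ p := hq a
    have hi : (1 - γ) * K / γ * (p * (if i = a then γ / K * (x a / p) else 0)) =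
        if i = a then (1 - γ) * x a else 0 := by
      split_ifs
      · field_simp
      · simp
    calc _ ≤ (1 - γ) * K / γ * (p * (exp3Potential γ i G +
          q * (γ / K * (x a / p) + (γ / K * (x a / p)) ^ 2) -
          if i = a then γ / K * (x a / p) else 0)) := by gcongr
      _ = (1 - γ) * K / γ * exp3Potential γ i G * p +
          ((1 - γ) * q * x a + ((1 - γ) * q) / p * (γ / K) * x a ^ 2) -
          (1 - γ) * K / γ * (p * (if i = a then γ / K * (x a / p) else 0)) := by
          generalize (if i = a then γ / K * (x a / p) else 0) = z
          field_simp
      _ ≤ _ := by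
          rw [hi]
          have e1 : (1 - γ) * q * x a ≤ p * x a := by gcongr
          have e2 : (1 - γ) * q / p ≤ 1 := (div_le_one hpa).2 hqa
          have e3 : (1 - γ) * q / p * (γ / K) * x a ^ 2 ≤ 1 * (γ / K) * 1 := by
            gcongr
            exact pow_le_one₀ hx0 hx1
          linarith
  have hsum := Finset.sum_le_sum fun a (_ : a ∈ Finset.univ) => hstep a
  rw [← Finset.mul_sum, Finset.sum_sub_distrib, Finset.sum_add_distrib, Finset.sum_add_distrib,
    ← Finset.mul_sum, sum_exp3Prob, Finset.sum_ite_eq, if_pos (Finset.mem_univ _),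
    Finset.sum_const, Finset.card_univ, Fintype.card_fin, nsmul_eq_mul, mul_div_cancel₀ _ hK.ne']
    at hsum
  -- The scaling leaves arm i only (1-γ)x_i; restoring x_i costs the second γ.
  have : γ * x i ≤ γ * 1 := by gcongr; exact (hx i).2
  linarith

/-! ### Blocks of rounds -/

/-- The arms `I` followed by `r` rounds with the arm `a`. -/
def extend {K t : ℕ} (I : Fin t → Fin K) (a : Fin K) : (r : ℕ) → Fin (t + r) → Fin K
  | 0 => I
  | r + 1 => (Fin.snoc (extend I a r) a : Fin (t + r + 1) → Fin K)

theorem history_extend {K t : ℕ} (adv : Adversary K) (I : Fin t → Fin K) (a : Fin K) (r : ℕ) :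
    ∃ L : List (Fin K × ℝ), L.length = r ∧ (∀ p ∈ L, p.1 = a) ∧
      (L.map Prod.snd).sum = ∑ k ∈ Finset.range r, adv (t + k) (extend I a (k + 1)) ∧
      history adv (t + r) (extend I a r) = L ++ history adv t I := by
  induction r with
  | zero => exact ⟨[], rfl, by simp, by simp, rfl⟩
  | succ r ih =>
    obtain ⟨L, h1, h2, h3, h4⟩ := ih
    refine ⟨(a, adv (t + r) (extend I a (r + 1))) :: L, by simp [h1], ?_, ?_, ?_⟩
    · simpa using h2
    · rw [Finset.sum_range_succ, List.map_cons, List.sum_cons, h3, add_comm]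
    · rw [List.cons_append, ← h4]
      exact history_snoc adv (t + r) (extend I a r) a

theorem blockHistory_history_extend {K : ℕ} [NeZero K] {τ t : ℕ} (hτ : 0 < τ) (adv : Adversary K)
    (I : Fin t → Fin K) (a : Fin K) :
    blockHistory τ (history adv (t + τ) (extend I a τ)) =
      (a, (∑ k ∈ Finset.range τ, adv (t + k) (extend I a (k + 1))) / τ) ::
        blockHistory τ (history adv t I) := by
  obtain ⟨L, h1, h2, h3, h4⟩ := history_extend adv I a τ
  rw [h4, blockHistory_of_le_length hτ (by simp [h1]), List.take_left' h1, List.drop_left' h1, h3]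
  congr 2
  cases L with
  | nil => exact absurd h1 hτ.ne
  | cons p L => simpa using h2 p List.mem_cons_self

theorem miniBatch_history_mul {K : ℕ} [NeZero K] {τ : ℕ} (Λ : Algorithm K)
    (adv : Adversary K) (m : ℕ) (I : Fin (τ * m) → Fin K) :
    miniBatch τ Λ (history adv (τ * m) I) = Λ (blockHistory τ (history adv (τ * m) I)) := by
  have hl := length_history adv (τ * m) I
  generalize history adv (τ * m) I = h at hl
  match h with
  | [] => simp [miniBatch, blockHistory]
  | (a, x) :: h =>
    simp only [List.length_cons] at hl
    simp [miniBatch, hl]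

theorem miniBatch_history_extend {K : ℕ} [NeZero K] {τ m r : ℕ} (hr : 0 < r) (hrτ : r < τ)
    (Λ : Algorithm K) (adv : Adversary K) (I : Fin (τ * m) → Fin K) (a : Fin K) :
    miniBatch τ Λ (history adv (τ * m + r) (extend I a r)) = PMF.pure a := by
  obtain ⟨r, rfl⟩ := Nat.exists_eq_succ_of_ne_zero hr.ne'
  have h : history adv (τ * m + (r + 1)) (extend I a (r + 1)) =
      (a, adv (τ * m + r) (extend I a (r + 1))) :: history adv (τ * m + r) (extend I a r) :=
    history_snoc adv (τ * m + r) (extend I a r) a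
  rw [Nat.succ_eq_add_one, h, miniBatch, length_history, if_neg]
  intro hd
  rw [add_assoc, Nat.dvd_add_right (Nat.dvd_mul_right τ m)] at hd
  exact absurd (Nat.le_of_dvd (Nat.succ_pos r) hd) (by omega)

/-- A block, even a truncated one, contains a single random draw, at its start; averaging over its
arms reduces to averaging over that draw. -/
theorem sum_law_block {K : ℕ} [NeZero K] {τ : ℕ} (Λ : Algorithm K) (adv : Adversary K)
    (m r : ℕ) (hrτ : r < τ) (F : (Fin (τ * m + (r + 1)) → Fin K) → ℝ) :
    ∑ J, (law (miniBatch τ Λ) adv (τ * m + (r + 1)) J).toReal * F J =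
      ∑ I, (law (miniBatch τ Λ) adv (τ * m) I).toReal *
        ∑ a, (Λ (blockHistory τ (history adv (τ * m) I)) a).toReal * F (extend I a (r + 1)) := by
  induction r with
  | zero =>
    refine (sum_law_succ (miniBatch τ Λ) adv (τ * m) F).trans ?_
    simp only [miniBatch_history_mul]
    rfl
  | succ r ih =>
    refine (sum_law_succ (miniBatch τ Λ) adv (τ * m + (r + 1)) F).trans ?_
    rw [ih (by omega)]
    refine Finset.sum_congr rfl fun I _ => ?_
    congr 1
    refine Finset.sum_congr rfl fun a _ => ?_
    rw [miniBatch_history_extend (Nat.succ_pos r) hrτ]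
    congr 1
    rw [Finset.sum_eq_single a]
    · simp only [PMF.pure_apply, if_true, ENNReal.toReal_one, one_mul]
      rfl
    · intro b _ hb
      simp [PMF.pure_apply, hb]
    · simp

/-! ### Total gains -/

theorem totalGain_snoc {K T : ℕ} (adv : Adversary K) (I : Fin T → Fin K) (a : Fin K) :
    totalGain adv (T + 1) (Fin.snoc I a : Fin (T + 1) → Fin K) =
      totalGain adv T I + adv T (Fin.snoc I a : Fin (T + 1) → Fin K) := by
  unfold totalGain
  rw [Fin.sum_univ_castSucc]
  congr 1
  refine Finset.sum_congr rfl fun t _ => congrArg (adv t) (funext fun s => ?_)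
  have h : Fin.castLE t.castSucc.isLt s = (Fin.castLE t.isLt s).castSucc := rfl
  rw [h, Fin.snoc_castSucc]

theorem totalGain_extend {K t : ℕ} (adv : Adversary K) (I : Fin t → Fin K) (a : Fin K) (r : ℕ) :
    totalGain adv (t + r) (extend I a r) =
      totalGain adv t I + ∑ k ∈ Finset.range r, adv (t + k) (extend I a (k + 1)) := by
  induction r with
  | zero => simp [extend]
  | succ r ih =>
    refine (totalGain_snoc adv (extend I a r) a).trans ?_
    rw [Finset.sum_range_succ, ih, add_assoc]
    rfl

theorem totalGain_switchingCosts_const {K : ℕ} (g : ℕ → Fin K → ℝ) (T : ℕ) (i : Fin K) :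
    totalGain (switchingCosts g) T (fun _ => i) = ∑ t ∈ Finset.range T, g t i := by
  simp [totalGain, switchingCosts, Finset.sum_range]

theorem switchingCosts_mem {K : ℕ} {g : ℕ → Fin K → ℝ}
    (hg : ∀ t i, g t i ∈ Set.Icc (0 : ℝ) 1) (t : ℕ) (I : Fin (t + 1) → Fin K) :
    switchingCosts g t I ∈ Set.Icc (0 : ℝ) 1 := by
  unfold switchingCosts
  split_ifs
  · exact hg _ _
  · simp

theorem switchingCosts_extend {K t : ℕ} (g : ℕ → Fin K → ℝ) (I : Fin t → Fin K) (a : Fin K)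
    {k : ℕ} (hk : 0 < k) : switchingCosts g (t + k) (extend I a (k + 1)) = g (t + k) a := by
  obtain ⟨k, rfl⟩ := Nat.exists_eq_succ_of_ne_zero hk.ne'
  have hlast : ∀ r, (extend I a (r + 1) : Fin (t + r + 1) → Fin K) (Fin.last (t + r)) = a :=
    fun r => Fin.snoc_last (α := fun _ => Fin K) _ _
  unfold switchingCosts
  rw [hlast, if_pos]
  rintro ⟨s, hs⟩ hst
  have hs' : s = t + k := by simp only at hst; omega
  subst hs'
  exact (Fin.snoc_castSucc (α := fun _ => Fin K) a (extend I a (k + 1)) (Fin.last (t + k))).trans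
    (hlast k)

/-- Within a block only the first round can be penalized, and it forfeits at most 1. -/
theorem sum_sub_one_le_sum_switchingCosts {K t : ℕ} {g : ℕ → Fin K → ℝ}
    (hg : ∀ t i, g t i ∈ Set.Icc (0 : ℝ) 1) (I : Fin t → Fin K) (a : Fin K) (τ : ℕ) :
    ∑ k ∈ Finset.range τ, g (t + k) a - 1 ≤
      ∑ k ∈ Finset.range τ, switchingCosts g (t + k) (extend I a (k + 1)) := by
  cases τ with
  | zero => simp
  | succ r =>
    rw [Finset.sum_range_succ', Finset.sum_range_succ' (fun k => switchingCosts g _ _),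
      Finset.sum_congr rfl fun k _ => switchingCosts_extend g I a (Nat.succ_pos k)]
    have h1 := (hg (t + 0) a).2
    have h2 := (switchingCosts_mem hg (t + 0) (extend I a (0 + 1))).1
    linarith

/-! ### Expected gains -/

/-- The expected total gain of the algorithm `Λ` in `T` rounds. -/
def expectedGain {K : ℕ} (Λ : Algorithm K) (adv : Adversary K) (T : ℕ) : ℝ :=
  ∑ I, (law Λ adv T I).toReal * totalGain adv T I

theorem expectedRegret_eq {K : ℕ} (Λ : Algorithm K) (adv : Adversary K) (T : ℕ) :
    expectedRegret Λ adv T =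
      (⨆ i : Fin K, totalGain adv T fun _ => i) - expectedGain Λ adv T := by
  simp only [expectedRegret, regret, mul_sub, Finset.sum_sub_distrib, ← Finset.sum_mul,
    sum_pmf_toReal, one_mul, expectedGain]

theorem law_congr_adversary {K : ℕ} (Λ : Algorithm K) {adv adv' : Adversary K} {T : ℕ}
    (h : ∀ t < T, adv t = adv' t) : law Λ adv T = law Λ adv' T := by
  induction T with
  | zero => rfl
  | succ T ih =>
    have h' : ∀ t < T, adv t = adv' t := fun s hs => h s (hs.trans (Nat.lt_succ_self T))
    simp only [law, ih h', history_congr_adversary h']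

theorem expectedGain_congr_adversary {K : ℕ} (Λ : Algorithm K) {adv adv' : Adversary K} {T : ℕ}
    (h : ∀ t < T, adv t = adv' t) : expectedGain Λ adv T = expectedGain Λ adv' T := by
  unfold expectedGain totalGain
  rw [law_congr_adversary Λ h]
  refine Finset.sum_congr rfl fun I _ => ?_
  congr 1
  exact Finset.sum_congr rfl fun t _ => by rw [h t t.isLt]

/-- Lets an incomplete last block be padded with rounds of zero gain. -/
theorem expectedGain_add_of_eq_zero {K : ℕ} (Λ : Algorithm K) {adv : Adversary K} {T : ℕ}
    (h : ∀ t ≥ T, ∀ I, adv t I = 0) (r : ℕ) :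
    expectedGain Λ adv (T + r) = expectedGain Λ adv T := by
  induction r with
  | zero => rfl
  | succ r ih =>
    rw [← ih]
    refine (sum_law_succ Λ adv (T + r) _).trans ?_
    refine Finset.sum_congr rfl fun I _ => ?_
    have h1 : ∀ a, totalGain adv (T + r + 1) (Fin.snoc I a : Fin (T + r + 1) → Fin K) =
        totalGain adv (T + r) I := fun a => by
      rw [totalGain_snoc, h (T + r) (Nat.le_add_right T r), add_zero]
    calc _ = (law Λ adv (T + r) I).toReal *
          ∑ a, (Λ (history adv (T + r) I) a).toReal * totalGain adv (T + r) I := by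
          exact congrArg _ (Finset.sum_congr rfl fun a _ => congrArg _ (h1 a))
      _ = _ := by rw [← Finset.sum_mul, sum_pmf_toReal, one_mul]

theorem totalGain_mem {K : ℕ} {adv : Adversary K} (hadv : ∀ t I, adv t I ∈ Set.Icc (0 : ℝ) 1)
    (T : ℕ) (I : Fin T → Fin K) : totalGain adv T I ∈ Set.Icc (0 : ℝ) T := by
  refine ⟨Finset.sum_nonneg fun t _ => (hadv _ _).1, ?_⟩
  refine (Finset.sum_le_card_nsmul _ _ 1 fun t _ => (hadv _ _).2).trans ?_
  simp

theorem expectedGain_mem {K : ℕ} (Λ : Algorithm K) {adv : Adversary K}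
    (hadv : ∀ t I, adv t I ∈ Set.Icc (0 : ℝ) 1) (T : ℕ) :
    expectedGain Λ adv T ∈ Set.Icc (0 : ℝ) T := by
  refine ⟨Finset.sum_nonneg fun I _ =>
    mul_nonneg ENNReal.toReal_nonneg (totalGain_mem hadv T I).1, ?_⟩
  calc expectedGain Λ adv T ≤ ∑ I, (law Λ adv T I).toReal * T :=
        Finset.sum_le_sum fun I _ =>
          mul_le_mul_of_nonneg_left (totalGain_mem hadv T I).2 ENNReal.toReal_nonneg
    _ = T := by rw [← Finset.sum_mul, sum_pmf_toReal, one_mul]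

theorem iSup_totalGain_mem {K : ℕ} [NeZero K] {adv : Adversary K}
    (hadv : ∀ t I, adv t I ∈ Set.Icc (0 : ℝ) 1) (T : ℕ) :
    (⨆ i : Fin K, totalGain adv T fun _ => i) ∈ Set.Icc (0 : ℝ) T :=
  ⟨Real.iSup_nonneg fun _ => (totalGain_mem hadv T _).1,
    ciSup_le fun _ => (totalGain_mem hadv T _).2⟩

theorem expectedRegret_le {K : ℕ} [NeZero K] (Λ : Algorithm K) {adv : Adversary K}
    (hadv : ∀ t I, adv t I ∈ Set.Icc (0 : ℝ) 1) (T : ℕ) : expectedRegret Λ adv T ≤ T := by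
  rw [expectedRegret_eq]
  linarith [(iSup_totalGain_mem hadv T).2, (expectedGain_mem Λ hadv T).1]

theorem abs_expectedRegret_le {K : ℕ} [NeZero K] (Λ : Algorithm K) {adv : Adversary K}
    (hadv : ∀ t I, adv t I ∈ Set.Icc (0 : ℝ) 1) (T : ℕ) : |expectedRegret Λ adv T| ≤ T := by
  refine abs_le.2 ⟨?_, expectedRegret_le Λ hadv T⟩
  rw [expectedRegret_eq]
  linarith [(iSup_totalGain_mem hadv T).1, (expectedGain_mem Λ hadv T).2]

/-! ### Regret of EXP3 in blocks -/

/-- One EXP3 step conditional on the past, multiplied by τ. The quantity tracked is scaled potential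
minus accumulated gain; the extra 1 is the possible penalty in the block average of the comparator
i. -/
theorem sum_block_step {K : ℕ} [NeZero K] {γ : unitInterval} (h0 : 0 < (γ : ℝ)) {τ : ℕ}
    (hτ : 0 < τ) {g : ℕ → Fin K → ℝ} (hg : ∀ t i, g t i ∈ Set.Icc (0 : ℝ) 1) (i : Fin K) {t : ℕ}
    (I : Fin t → Fin K) :
    ∑ a, (exp3 γ (blockHistory τ (history (switchingCosts g) t I)) a).toReal *
        (τ * ((1 - γ) * K / γ * exp3Potential γ i (exp3Estimate γ
          (blockHistory τ (history (switchingCosts g) (t + τ) (extend I a τ))))) -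
          totalGain (switchingCosts g) (t + τ) (extend I a τ)) +
        ∑ k ∈ Finset.range τ, g (t + k) i ≤
      τ * ((1 - γ) * K / γ * exp3Potential γ i (exp3Estimate γ
          (blockHistory τ (history (switchingCosts g) t I)))) -
        totalGain (switchingCosts g) t I + (1 + 2 * γ * τ) := by
  have hτ' : (0 : ℝ) < τ := Nat.cast_pos.2 hτ
  set x : Fin K → ℝ := fun a =>
    (∑ k ∈ Finset.range τ, switchingCosts g (t + k) (extend I a (k + 1))) / τ with hxdef
  have hxτ : ∀ a, ∑ k ∈ Finset.range τ, switchingCosts g (t + k) (extend I a (k + 1)) =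
      τ * x a := fun a => by rw [hxdef]; field_simp
  have hx : ∀ a, x a ∈ Set.Icc (0 : ℝ) 1 := fun a => by
    refine ⟨div_nonneg (Finset.sum_nonneg fun k _ => (switchingCosts_mem hg _ _).1) hτ'.le,
      div_le_one_of_le₀ ?_ hτ'.le⟩
    refine (Finset.sum_le_card_nsmul _ _ 1 fun k _ => (switchingCosts_mem hg _ _).2).trans ?_
    simp
  have hi := sum_sub_one_le_sum_switchingCosts hg I i τ
  rw [hxτ] at hi
  set h := blockHistory τ (history (switchingCosts g) t I) with hh
  have hstep := sum_exp3Prob_mul_potential_le h0 γ.2.2 (exp3Estimate γ h) x hx i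
  have hest : ∀ a, exp3Estimate γ
      (blockHistory τ (history (switchingCosts g) (t + τ) (extend I a τ))) =
      fun j => exp3Estimate γ h j + if j = a then x a / exp3Prob γ (exp3Estimate γ h) a else 0 := by
    intro a
    rw [blockHistory_history_extend hτ]
    funext j
    simp only [exp3Estimate]
    congr 1
    split_ifs with hj
    · rw [hj]
    · rfl
  simp only [hest, totalGain_extend, hxτ, exp3_apply_toReal]
  have hsum := sum_exp3Prob (γ : ℝ) (exp3Estimate γ h)
  set Φ : Fin K → ℝ := fun a => exp3Potential γ i
    (fun j => exp3Estimate γ h j + if j = a then x a / exp3Prob γ (exp3Estimate γ h) a else 0)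
  set p := exp3Prob (γ : ℝ) (exp3Estimate γ h)
  set R := totalGain (switchingCosts g) t I
  have hexpand : ∑ a, p a * ((τ : ℝ) * ((1 - (γ : ℝ)) * K / γ * Φ a) - (R + τ * x a)) =
      (τ : ℝ) * ((1 - (γ : ℝ)) * K / γ * ∑ a, p a * Φ a) - R - τ * ∑ a, p a * x a := by
    calc _ = ∑ a, ((τ : ℝ) * ((1 - (γ : ℝ)) * K / γ) * (p a * Φ a) - R * p a - τ * (p a * x a)) :=
          Finset.sum_congr rfl fun a _ => by ring
      _ = (τ : ℝ) * ((1 - (γ : ℝ)) * K / γ) * ∑ a, p a * Φ a - R * ∑ a, p a -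
          τ * ∑ a, p a * x a := by
          simp only [Finset.sum_sub_distrib, Finset.mul_sum]
      _ = _ := by rw [hsum]; ring
  have hmul := mul_le_mul_of_nonneg_left hstep hτ'.le
  calc _ = (τ : ℝ) * ((1 - (γ : ℝ)) * K / γ * ∑ a, p a * Φ a) - R - τ * ∑ a, p a * x a +
        ∑ k ∈ Finset.range τ, g (t + k) i := by rw [← hexpand]
    _ ≤ _ := by linarith

/-- The block inequality telescopes in expectation, starting from potential ln K; the final
potential is nonnegative and is dropped. -/
theorem sum_gain_sub_expectedGain_blocks_le {K : ℕ} [NeZero K] {γ : unitInterval}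
    (h0 : 0 < (γ : ℝ)) {τ : ℕ} (hτ : 0 < τ) {g : ℕ → Fin K → ℝ}
    (hg : ∀ t i, g t i ∈ Set.Icc (0 : ℝ) 1) (i : Fin K) (m : ℕ) :
    ∑ t ∈ Finset.range (τ * m), g t i -
        expectedGain (miniBatch τ (exp3 (K := K) γ)) (switchingCosts g) (τ * m) ≤
      τ * ((1 - γ) * K / γ * Real.log K) + m * (1 + 2 * γ * τ) := by
  set Λ : Algorithm K := miniBatch τ (exp3 γ) with hΛ
  set adv := switchingCosts g with hadv
  set Φ : (t : ℕ) → (Fin t → Fin K) → ℝ := fun t I =>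
    τ * ((1 - γ) * K / γ * exp3Potential γ i (exp3Estimate γ (blockHistory τ (history adv t I))))
    with hΦ
  have hmain : ∀ m : ℕ, ∑ I, (law Λ adv (τ * m) I).toReal *
      (Φ (τ * m) I - totalGain adv (τ * m) I) + ∑ t ∈ Finset.range (τ * m), g t i ≤
      τ * ((1 - γ) * K / γ * Real.log K) + m * (1 + 2 * γ * τ) := by
    intro m
    induction m with
    | zero =>
      have h1 : ∀ I : Fin 0 → Fin K, Φ 0 I = τ * ((1 - γ) * K / γ * Real.log K) := by
        intro I
        have h2 : blockHistory τ (history adv 0 I) = [] := blockHistory_of_length_lt hτ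
        simp only [hΦ, h2, exp3Estimate, exp3Potential_zero]
      have h2 : ∀ I : Fin 0 → Fin K, totalGain adv 0 I = 0 := fun I => by simp [totalGain]
      refine le_of_eq ?_
      simp only [Nat.cast_zero, zero_mul, add_zero]
      rw [show τ * 0 = 0 from rfl]
      simp only [h1, h2, Finset.range_zero, Finset.sum_empty, add_zero, sub_zero]
      rw [← Finset.sum_mul, sum_pmf_toReal, one_mul]
    | succ m ih =>
      obtain ⟨r, rfl⟩ := Nat.exists_eq_succ_of_ne_zero hτ.ne'
      have hb := sum_law_block (exp3 γ) adv m r (Nat.lt_succ_self r)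
        (fun J => Φ _ J - totalGain adv _ J)
      have hsum : ∑ t ∈ Finset.range ((r + 1) * (m + 1)), g t i =
          ∑ t ∈ Finset.range ((r + 1) * m), g t i +
            ∑ k ∈ Finset.range (r + 1), g ((r + 1) * m + k) i := by
        rw [Nat.mul_succ, Finset.sum_range_add]
      have hstep : ∀ I : Fin ((r + 1) * m) → Fin K, _ := fun I =>
        sum_block_step h0 hτ hg i I
      have hle : ∑ I, (law Λ adv ((r + 1) * m) I).toReal *
          (∑ a, (exp3 γ (blockHistory (r + 1) (history adv ((r + 1) * m) I)) a).toReal *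
            (Φ _ (extend I a (r + 1)) - totalGain adv _ (extend I a (r + 1))) +
            ∑ k ∈ Finset.range (r + 1), g ((r + 1) * m + k) i) ≤
          ∑ I, (law Λ adv ((r + 1) * m) I).toReal *
            (Φ _ I - totalGain adv _ I + (1 + 2 * γ * ((r + 1 : ℕ) : ℝ))) :=
        Finset.sum_le_sum fun I _ =>
          mul_le_mul_of_nonneg_left (hstep I) ENNReal.toReal_nonneg
      simp only [mul_add (ENNReal.toReal _), Finset.sum_add_distrib] at hle
      simp only [← Finset.sum_mul, sum_pmf_toReal, one_mul] at hle
      have hb' : ∑ J, (law Λ adv ((r + 1) * (m + 1)) J).toReal *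
          (Φ ((r + 1) * (m + 1)) J - totalGain adv ((r + 1) * (m + 1)) J) = _ := hb
      rw [Nat.succ_eq_add_one] at ih ⊢
      rw [hb', hsum]
      push_cast at hle ih ⊢
      linarith
  have hΦ0 : ∀ t I, 0 ≤ Φ t I := fun t I => by
    have := exp3Potential_nonneg (γ : ℝ) i
      (exp3Estimate γ (blockHistory τ (history adv t I)))
    have hγ : 0 ≤ 1 - (γ : ℝ) := by linarith [γ.2.2]
    positivity
  have hsplit : -expectedGain Λ adv (τ * m) ≤ ∑ I, (law Λ adv (τ * m) I).toReal *
      (Φ (τ * m) I - totalGain adv (τ * m) I) := by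
    rw [expectedGain, ← Finset.sum_neg_distrib]
    refine Finset.sum_le_sum fun I _ => ?_
    have : 0 ≤ (law Λ adv (τ * m) I).toReal * Φ (τ * m) I :=
      mul_nonneg ENNReal.toReal_nonneg (hΦ0 _ _)
    rw [mul_sub]
    linarith
  linarith [hmain m]

/-- Regret of EXP3 in blocks of `τ` rounds, for an arbitrary parameter `γ`. -/
theorem expectedRegret_miniBatch_exp3_le {K : ℕ} [NeZero K] {γ : unitInterval}
    (h0 : 0 < (γ : ℝ)) {τ : ℕ} (hτ : 0 < τ) {g : ℕ → Fin K → ℝ}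
    (hg : ∀ t i, g t i ∈ Set.Icc (0 : ℝ) 1) {T n : ℕ} (hn : T ≤ τ * n) :
    expectedRegret (miniBatch τ (exp3 γ)) (switchingCosts g) T ≤
      τ * ((1 - γ) * K / γ * Real.log K) + n * (1 + 2 * γ * τ) := by
  rw [expectedRegret_eq, sub_le_iff_le_add]
  refine ciSup_le fun i => ?_
  -- Padding by zeros up to τ n rounds completes the last block without changing either total gain.
  set g' : ℕ → Fin K → ℝ := fun t i => if t < T then g t i else 0 with hg'
  have hgg : ∀ t i, g' t i ∈ Set.Icc (0 : ℝ) 1 := fun t i => by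
    simp only [hg']
    split_ifs
    · exact hg t i
    · simp
  have h1 := sum_gain_sub_expectedGain_blocks_le h0 hτ hgg i n
  obtain ⟨r, hr⟩ := Nat.exists_eq_add_of_le hn
  have hadv : ∀ t < T, switchingCosts g' t = switchingCosts g t := fun t ht => by
    funext I
    simp [switchingCosts, hg', ht]
  have hzero : ∀ t ≥ T, ∀ I, switchingCosts g' t I = 0 := fun t ht I => by
    simp [switchingCosts, hg', not_lt.2 ht]
  rw [hr, expectedGain_add_of_eq_zero _ hzero, expectedGain_congr_adversary _ hadv,
    Finset.sum_range_add] at h1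
  have h2 : ∑ t ∈ Finset.range T, g' t i = ∑ t ∈ Finset.range T, g t i :=
    Finset.sum_congr rfl fun t ht => if_pos (Finset.mem_range.1 ht)
  have h3 : ∑ x ∈ Finset.range r, g' (T + x) i = 0 :=
    Finset.sum_eq_zero fun t _ => if_neg (by omega)
  rw [totalGain_switchingCosts_const]
  rw [h2, h3] at h1
  linarith

/-- With s = √(nK ln K), the untruncated rate ρ satisfies K ln K/ρ ≤ 2s and nρ ≤ s, because 1 < e -
1 < 4. The two contributions add up to 4τs. -/
theorem expectedRegret_exp3Tau_le {K T τ : ℕ} [NeZero K] (hK : 2 ≤ K) (hT : 1 ≤ T) (hτ : 0 < τ)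
    {g : ℕ → Fin K → ℝ} (hg : ∀ t i, g t i ∈ Set.Icc (0 : ℝ) 1) :
    expectedRegret (exp3Tau K T τ) (switchingCosts g) T ≤
      4 * τ * Real.sqrt (K * Real.log K * ⌈(T : ℝ) / τ⌉₊) + ⌈(T : ℝ) / τ⌉₊ := by
  set n := ⌈(T : ℝ) / τ⌉₊ with hn
  have hτ' : (0 : ℝ) < τ := Nat.cast_pos.2 hτ
  have hT' : (0 : ℝ) < T := Nat.cast_pos.2 hT
  have hn0 : (0 : ℝ) < n := Nat.cast_pos.2 (Nat.ceil_pos.2 (by positivity))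
  have hTn : T ≤ τ * n := by
    have := Nat.le_ceil ((T : ℝ) / τ)
    rw [div_le_iff₀ hτ'] at this
    rw [← Nat.cast_le (α := ℝ)]
    push_cast
    linarith
  have hK' : (1 : ℝ) < K := by exact_mod_cast hK
  have hlog : 0 < Real.log K := Real.log_pos hK'
  set A := K * Real.log K with hA
  have hA0 : 0 < A := by positivity
  have he1 : 1 < Real.exp 1 - 1 := by linarith [Real.exp_one_gt_d9]
  have he4 : Real.exp 1 - 1 < 4 := by linarith [Real.exp_one_lt_d9]
  set ρ := Real.sqrt (A / ((Real.exp 1 - 1) * n)) with hρ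
  have hρ0 : 0 < ρ := Real.sqrt_pos.2 (by positivity)
  have hγ : ((exp3Rate K n : unitInterval) : ℝ) = min 1 ρ := rfl
  have h0 : 0 < ((exp3Rate K n : unitInterval) : ℝ) := by rw [hγ]; exact lt_min one_pos hρ0
  have hmain := expectedRegret_miniBatch_exp3_le h0 hτ hg hTn
  refine hmain.trans ?_
  rw [hγ]
  set s := Real.sqrt (A * n) with hs
  have hs0 : 0 < s := Real.sqrt_pos.2 (by positivity)
  have hss : s ^ 2 = A * n := Real.sq_sqrt (by positivity)
  have hρρ : ρ ^ 2 = A / ((Real.exp 1 - 1) * n) := Real.sq_sqrt (by positivity)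
  -- If the rate is truncated to 1, the potential term vanishes and n ≤ s bounds the term 2nτ.
  rcases le_total 1 ρ with h | h
  · rw [min_eq_left h]
    have hns : (n : ℝ) ≤ s := by
      refine Real.le_sqrt_of_sq_le ?_
      have h1 : 1 ≤ ρ ^ 2 := one_le_pow₀ h
      rw [hρρ, le_div_iff₀ (by positivity)] at h1
      have : (n : ℝ) ≤ A := by nlinarith
      nlinarith
    have : (n : ℝ) * τ ≤ s * τ := by gcongr
    have : 0 ≤ s * τ := by positivity
    simp only [sub_self, zero_mul, zero_div, mul_zero, zero_add, mul_one]
    linarith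
  · rw [min_eq_right h]
    have hnρ : n * ρ ≤ s := by
      refine Real.le_sqrt_of_sq_le ?_
      rw [mul_pow, hρρ]
      have : (n : ℝ) ^ 2 * (A / ((Real.exp 1 - 1) * n)) = A * n / (Real.exp 1 - 1) := by
        field_simp
      rw [this]
      exact div_le_self (by positivity) he1.le
    have hAρ : A / ρ ≤ 2 * s := by
      rw [div_le_iff₀ hρ0]
      refine le_of_sq_le_sq ?_ (by positivity)
      rw [mul_pow (2 * s), mul_pow 2, hss, hρρ]
      have : 2 ^ 2 * (A * n) * (A / ((Real.exp 1 - 1) * n)) = A ^ 2 * (4 / (Real.exp 1 - 1)) := by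
        field_simp; norm_num
      rw [this]
      exact le_mul_of_one_le_right (by positivity) ((one_le_div (by positivity)).2 he4.le)
    have e1 : τ * ((1 - ρ) * K / ρ * Real.log K) ≤ τ * (2 * s) := by
      refine mul_le_mul_of_nonneg_left ?_ hτ'.le
      calc (1 - ρ) * K / ρ * Real.log K = (1 - ρ) * (A / ρ) := by rw [hA]; ring
        _ ≤ 1 * (A / ρ) := by gcongr; linarith
        _ ≤ 2 * s := by linarith
    have e2 : n * ρ * τ ≤ s * τ := by gcongr
    linarith

/-! ### Measurability -/

/-- A random history with deterministic arms and measurable gains. -/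
def MeasurableHistory {K : ℕ} {Ω : Type*} [MeasurableSpace Ω] (H : Ω → List (Fin K × ℝ)) : Prop :=
  ∃ l : List (Fin K × (Ω → ℝ)), (∀ p ∈ l, Measurable p.2) ∧
    ∀ ω, H ω = l.map fun p => (p.1, p.2 ω)

theorem measurable_exp3Prob {K : ℕ} {Ω : Type*} [MeasurableSpace Ω] (γ : ℝ) {G : Ω → Fin K → ℝ}
    (hG : ∀ i, Measurable fun ω => G ω i) (i : Fin K) :
    Measurable fun ω => exp3Prob γ (G ω) i := by
  unfold exp3Prob
  have h : ∀ j, Measurable fun ω => Real.exp (γ / K * G ω j) := fun j =>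
    ((hG j).const_mul _).exp
  have hs : Measurable fun ω => ∑ j, Real.exp (γ / K * G ω j) :=
    Finset.measurable_sum _ fun j _ => h j
  exact (((h i).div hs).const_mul _).add_const _

theorem MeasurableHistory.exp3Estimate {K : ℕ} {Ω : Type*} [MeasurableSpace Ω] (γ : ℝ)
    {H : Ω → List (Fin K × ℝ)} (hH : MeasurableHistory H) (i : Fin K) :
    Measurable fun ω => exp3Estimate γ (H ω) i := by
  obtain ⟨l, hl, hHl⟩ := hH
  simp only [hHl]
  clear hHl
  induction l generalizing i with
  | nil => exact measurable_const
  | cons p l ih =>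
    have ih' := fun j => ih j fun q hq => hl q (List.mem_cons_of_mem _ hq)
    simp only [List.map_cons, PrivateBandit.exp3Estimate]
    split_ifs
    · exact (ih' i).add ((hl p List.mem_cons_self).div (measurable_exp3Prob γ ih' i))
    · exact (ih' i).add measurable_const

theorem measurable_list_sum_map {α Ω : Type*} [MeasurableSpace Ω] (l : List α) (f : α → Ω → ℝ)
    (hf : ∀ p ∈ l, Measurable (f p)) : Measurable fun ω => (l.map fun p => f p ω).sum := by
  induction l with
  | nil => exact measurable_const
  | cons p l ih =>
    simp only [List.map_cons, List.sum_cons]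
    exact (hf p List.mem_cons_self).add (ih fun q hq => hf q (List.mem_cons_of_mem _ hq))

theorem MeasurableHistory.blockHistory {K : ℕ} [NeZero K] {Ω : Type*} [MeasurableSpace Ω] (τ : ℕ)
    {H : Ω → List (Fin K × ℝ)} (hH : MeasurableHistory H) :
    MeasurableHistory fun ω => blockHistory τ (H ω) := by
  obtain ⟨l, hl, hHl⟩ := hH
  refine ⟨(List.range (l.length / τ)).map fun j =>
    ((((l.drop (j * τ)).take τ).map Prod.fst).headD 0,
      fun ω => (((l.drop (j * τ)).take τ).map fun p => p.2 ω).sum / τ), ?_, fun ω => ?_⟩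
  · intro p hp
    obtain ⟨j, -, rfl⟩ := List.mem_map.1 hp
    refine (measurable_list_sum_map _ (fun p : Fin K × (Ω → ℝ) => p.2) fun p hp => ?_).div_const _
    exact hl p (List.mem_of_mem_drop (List.mem_of_mem_take hp))
  · simp only [PrivateBandit.blockHistory, hHl, List.length_map, List.map_map, ← List.map_drop,
      ← List.map_take]
    rfl

theorem MeasurableHistory.miniBatch_exp3 {K : ℕ} [NeZero K] {Ω : Type*} [MeasurableSpace Ω]
    (τ : ℕ) (γ : unitInterval) {H : Ω → List (Fin K × ℝ)} (hH : MeasurableHistory H) (a : Fin K) :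
    Measurable fun ω => (miniBatch τ (exp3 γ) (H ω) a).toReal := by
  have key : ∀ {H : Ω → List (Fin K × ℝ)}, MeasurableHistory H →
      Measurable fun ω => (exp3 γ (H ω) a).toReal := fun hH => by
    simp only [exp3_apply_toReal]
    exact measurable_exp3Prob _ (fun i => hH.exp3Estimate γ i) a
  have hb := key (hH.blockHistory τ)
  obtain ⟨l, -, hHl⟩ := hH
  simp only [hHl] at hb ⊢
  match l with
  | [] => exact measurable_const
  | p :: l =>
    simp only [List.map_cons, List.length_map, miniBatch] at hb ⊢
    split_ifs
    · exact hb
    · exact measurable_const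

theorem measurable_switchingCosts {K : ℕ} {Ω : Type*} [MeasurableSpace Ω]
    {g : Ω → ℕ → Fin K → ℝ} (hg : ∀ t i, Measurable fun ω => g ω t i) (t : ℕ)
    (I : Fin (t + 1) → Fin K) : Measurable fun ω => switchingCosts (g ω) t I := by
  unfold switchingCosts
  split_ifs
  · exact hg _ _
  · exact measurable_const

theorem measurableHistory_history {K : ℕ} {Ω : Type*} [MeasurableSpace Ω] {adv : Ω → Adversary K}
    (hadv : ∀ t I, Measurable fun ω => adv ω t I) (t : ℕ) (I : Fin t → Fin K) :
    MeasurableHistory fun ω => history (adv ω) t I := by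
  induction t with
  | zero => exact ⟨[], by simp, fun _ => rfl⟩
  | succ t ih =>
    obtain ⟨l, hl, hHl⟩ := ih (Fin.init I)
    refine ⟨(I (Fin.last t), fun ω => adv ω t I) :: l, fun p hp => ?_, fun ω => ?_⟩
    · rcases List.mem_cons.1 hp with rfl | hp
      · exact hadv t I
      · exact hl p hp
    · simp [history, hHl]

/-- For fixed arms the law is a finite product of conditional probabilities, each a measurable
function of the gains. -/
theorem measurable_law {K : ℕ} [NeZero K] {Ω : Type*} [MeasurableSpace Ω] {adv : Ω → Adversary K}
    (hadv : ∀ t I, Measurable fun ω => adv ω t I) (τ : ℕ) (γ : unitInterval) (T : ℕ)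
    (I : Fin T → Fin K) :
    Measurable fun ω => (law (miniBatch τ (exp3 γ)) (adv ω) T I).toReal := by
  induction T with
  | zero => simp [law_zero_toReal]
  | succ T ih =>
    rw [← Fin.snoc_init_self I]
    simp only [law_succ, ENNReal.toReal_mul]
    exact (ih _).mul ((measurableHistory_history hadv T _).miniBatch_exp3 τ γ _)

theorem measurable_totalGain {K : ℕ} {Ω : Type*} [MeasurableSpace Ω] {adv : Ω → Adversary K}
    (hadv : ∀ t I, Measurable fun ω => adv ω t I) (T : ℕ) (I : Fin T → Fin K) :
    Measurable fun ω => totalGain (adv ω) T I :=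
  Finset.measurable_sum _ fun _ _ => hadv _ _

theorem measurable_expectedRegret {K : ℕ} [NeZero K] {Ω : Type*} [MeasurableSpace Ω]
    {adv : Ω → Adversary K} (hadv : ∀ t I, Measurable fun ω => adv ω t I) (τ : ℕ)
    (γ : unitInterval) (T : ℕ) :
    Measurable fun ω => expectedRegret (miniBatch τ (exp3 γ)) (adv ω) T := by
  refine Finset.measurable_sum _ fun I _ => (measurable_law hadv τ γ T I).mul ?_
  exact (Measurable.iSup fun i => measurable_totalGain hadv T _).sub
    (measurable_totalGain hadv T I)

theorem integrable_expectedRegret_exp3Tau {K : ℕ} [NeZero K] {Ω : Type*} [MeasurableSpace Ω]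
    (μ : Measure Ω) [IsFiniteMeasure μ] {g : Ω → ℕ → Fin K → ℝ}
    (hg : ∀ t i, Measurable fun ω => g ω t i) (hg' : ∀ ω t i, g ω t i ∈ Set.Icc (0 : ℝ) 1)
    (τ T : ℕ) :
    Integrable (fun ω => expectedRegret (exp3Tau K T τ) (switchingCosts (g ω)) T) μ :=
  .of_bound (measurable_expectedRegret (measurable_switchingCosts hg) τ _ T).aestronglyMeasurable T
    (.of_forall fun ω => abs_expectedRegret_le _ (switchingCosts_mem (hg' ω)) T)

/-! ### The choice of the block length -/

theorem one_le_mul_log {K : ℕ} (hK : 2 ≤ K) : 1 ≤ K * Real.log K := by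
  have h2 : (2 : ℝ) ≤ K := by exact_mod_cast hK
  have h1 : Real.log 2 ≤ Real.log K := Real.log_le_log (by norm_num) h2
  nlinarith [Real.log_two_gt_d9]

theorem rpow_one_third_pow {x : ℝ} (hx : 0 ≤ x) : (x ^ (1 / 3 : ℝ)) ^ 3 = x := by
  rw [← Real.rpow_natCast, ← Real.rpow_mul hx]
  norm_num

theorem le_blockLength_pow {T : ℕ} {ε δ : ℝ} (hε : 0 < ε) (hδ : 0 < δ) (hδ1 : δ < 1) :
    (4 * T * ε + 2 * T * Real.log (1 / δ)) / ε ^ 2 ≤ (blockLength T ε δ : ℝ) ^ 3 := by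
  have hL : 0 < Real.log (1 / δ) := log_one_div_pos hδ hδ1
  have h0 : 0 ≤ (4 * T * ε + 2 * T * Real.log (1 / δ)) / ε ^ 2 := by positivity
  calc _ = (((4 * T * ε + 2 * T * Real.log (1 / δ)) / ε ^ 2) ^ (1 / 3 : ℝ)) ^ 3 :=
        (rpow_one_third_pow h0).symm
    _ ≤ _ := by
        unfold blockLength
        gcongr
        exact Nat.le_ceil _

theorem blockLength_pos {T : ℕ} (hT : 1 ≤ T) {ε δ : ℝ} (hε : 0 < ε) (hδ : 0 < δ) (hδ1 : δ < 1) :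
    0 < blockLength T ε δ := by
  have hL : 0 < Real.log (1 / δ) := log_one_div_pos hδ hδ1
  have hT' : (0 : ℝ) < T := Nat.cast_pos.2 hT
  exact Nat.ceil_pos.2 (by positivity)

/-- In terms of u = T^(1/3), w = (√L/ε)^(1/3) and a = √(K ln K), the target is u²aw. The unrounded
length τ₀ is comparable to uw², so τ√(nK ln K) is of order √(τT) a, that is u²aw. The block count n
is of order T/τ, that is u²/w², which 1 ≤ √c a w³ brings below the target. -/
theorem expectedRegret_exp3Tau_blockLength_le {c : ℝ} (hc : 0 < c) {K T : ℕ} [NeZero K] {ε δ : ℝ}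
    (hT : 1 ≤ T) (hε : 0 < ε) (hδ : 0 < δ) (hδ1 : δ < 1) (h1 : ε ≤ c * Real.log (1 / δ))
    (h2 : ε ^ 2 ≤ c * (K * Real.log K * Real.log (1 / δ))) {g : ℕ → Fin K → ℝ}
    (hg : ∀ t i, g t i ∈ Set.Icc (0 : ℝ) 1) :
    expectedRegret (exp3Tau K T (blockLength T ε δ)) (switchingCosts g) T ≤
      (8 * Real.sqrt ((4 * c + 2) ^ (1 / 3 : ℝ)) + 2 * Real.sqrt c) *
        ((T : ℝ) ^ (2 / 3 : ℝ) * Real.sqrt (K * Real.log K) *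
          (Real.sqrt (Real.log (1 / δ)) / ε) ^ (1 / 3 : ℝ)) := by
  have hL : 0 < Real.log (1 / δ) := log_one_div_pos hδ hδ1
  have hT' : (0 : ℝ) < T := Nat.cast_pos.2 hT
  -- For K = 1 the second condition would read ε² ≤ 0.
  have hK : 2 ≤ K := by
    by_contra hK
    have : K = 1 := by have := NeZero.pos K; omega
    subst this
    simp only [Nat.cast_one, Real.log_one, mul_zero, zero_mul] at h2
    exact absurd h2 (not_le.2 (by positivity))
  have hA := one_le_mul_log hK
  have htriv := expectedRegret_le (exp3Tau K T (blockLength T ε δ)) (switchingCosts_mem hg) T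
  have hτpos := blockLength_pos hT hε hδ hδ1
  have hreg := expectedRegret_exp3Tau_le hK hT hτpos hg
  set R := expectedRegret (exp3Tau K T (blockLength T ε δ)) (switchingCosts g) T
  set A := K * Real.log K
  set L := Real.log (1 / δ)
  set τ := blockLength T ε δ with hτ
  set n := ⌈(T : ℝ) / τ⌉₊ with hn
  set a := Real.sqrt A with ha
  have ha1 : 1 ≤ a := Real.one_le_sqrt.2 hA
  have ha2 : a ^ 2 = A := Real.sq_sqrt (by linarith)
  set u := (T : ℝ) ^ (1 / 3 : ℝ) with hu
  have hu0 : 0 < u := by positivity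
  have hu3 : u ^ 3 = T := rpow_one_third_pow hT'.le
  have hu2 : (T : ℝ) ^ (2 / 3 : ℝ) = u ^ 2 := by
    rw [hu, ← Real.rpow_natCast, ← Real.rpow_mul hT'.le]; norm_num
  set w := (Real.sqrt L / ε) ^ (1 / 3 : ℝ) with hw
  have hw0 : 0 < w := by positivity
  have hw3 : w ^ 3 = Real.sqrt L / ε := rpow_one_third_pow (by positivity)
  have hw6 : w ^ 6 = L / ε ^ 2 := by
    rw [show w ^ 6 = (w ^ 3) ^ 2 by ring, hw3, div_pow, Real.sq_sqrt hL.le]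
  set κ := (4 * c + 2) ^ (1 / 3 : ℝ) with hκ
  have hκ0 : 0 < κ := by positivity
  have hκ3 : κ ^ 3 = 4 * c + 2 := rpow_one_third_pow (by positivity)
  set k := Real.sqrt κ with hk
  have hk0 : 0 < k := Real.sqrt_pos.2 hκ0
  have hk2 : k ^ 2 = κ := Real.sq_sqrt hκ0.le
  set d := Real.sqrt c with hd
  have hd0 : 0 < d := Real.sqrt_pos.2 hc
  have hd2 : d ^ 2 = c := Real.sq_sqrt hc.le
  have hdaw : 1 ≤ d * a * w ^ 3 := by
    refine le_of_sq_le_sq ?_ (by positivity)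
    rw [mul_pow, mul_pow, hd2, ha2, ← pow_mul, hw6, one_pow, ← mul_div_assoc,
      le_div_iff₀ (by positivity)]
    linarith
  set τ₀ := ((4 * T * ε + 2 * T * L) / ε ^ 2) ^ (1 / 3 : ℝ) with hτ₀
  have hτ₀0 : 0 < τ₀ := by positivity
  have hτ₀3 : τ₀ ^ 3 = (4 * T * ε + 2 * T * L) / ε ^ 2 := rpow_one_third_pow (by positivity)
  have hlo : u * w ^ 2 ≤ τ₀ := by
    refine le_of_pow_le_pow_left₀ (n := 3) (by norm_num) hτ₀0.le ?_
    rw [mul_pow, ← pow_mul, hu3, hw6, hτ₀3, ← mul_div_assoc]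
    gcongr
    have : 0 < T * ε := by positivity
    have : 0 < T * L := by positivity
    linarith
  -- This is the use of ε ≤ cL: 4ε + 2L ≤ (4c + 2)L, whence κ.
  have hhi : τ₀ ≤ κ * (u * w ^ 2) := by
    refine le_of_pow_le_pow_left₀ (n := 3) (by norm_num) (by positivity) ?_
    rw [mul_pow, mul_pow u, ← pow_mul, hu3, hw6, hτ₀3, hκ3, ← mul_div_assoc, ← mul_div_assoc]
    gcongr
    have : T * ε ≤ T * (c * L) := by gcongr
    linarith
  have hτceil : τ = ⌈τ₀⌉₊ := rfl
  rw [hu2]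
  have hkey : ∀ x y : ℝ, 0 ≤ x → 0 ≤ y → R ≤ 8 * x * (u ^ 2 * a * w) + 2 * y * (u ^ 2 * a * w) →
    x ≤ k → y ≤ d → R ≤ (8 * k + 2 * d) * (u ^ 2 * a * w) := by
    intro x y _ _ h hx hy
    refine h.trans ?_
    rw [← add_mul]
    gcongr
  -- If T is shorter than one block, then T < τ₀ because T is an integer, and the trivial bound T =
  -- u³ is already at most k u²aw.
  rcases lt_or_ge T τ with hTτ | hTτ
  · have h3 : (T : ℝ) < τ₀ := Nat.lt_ceil.1 (hτceil ▸ hTτ)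
    have h4 : u ≤ k * w := by
      refine le_of_sq_le_sq ?_ (by positivity)
      rw [mul_pow, hk2]
      have h5 : u * u ^ 2 ≤ u * (κ * w ^ 2) := by
        calc u * u ^ 2 = T := by rw [← hu3]; ring
          _ ≤ κ * (u * w ^ 2) := h3.le.trans hhi
          _ = _ := by ring
      exact le_of_mul_le_mul_left h5 hu0
    refine hkey k 0 hk0.le le_rfl ?_ le_rfl hd0.le
    have h5 : (T : ℝ) ≤ k * (u ^ 2 * a * w) := by
      calc (T : ℝ) = u ^ 2 * 1 * u := by rw [← hu3]; ring
        _ ≤ u ^ 2 * a * (k * w) := by gcongr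
        _ = _ := by ring
    have : 0 ≤ k * (u ^ 2 * a * w) := by positivity
    linarith
  -- If τ₀ < 1, rounding up is not within a factor 2 of τ₀; instead uw² ≤ 1 ≤ d a w³ makes the
  -- trivial bound T sufficient. Otherwise τ ≤ 2τ₀ and nτ ≤ 2T.
  rcases lt_or_ge τ₀ 1 with hτ1 | hτ1
  · have h4 : u ≤ d * a * w := by
      have h5 : u * w ^ 2 ≤ (d * a * w) * w ^ 2 := by
        calc u * w ^ 2 ≤ 1 := hlo.trans hτ1.le
          _ ≤ d * a * w ^ 3 := hdaw
          _ = _ := by ring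
      exact le_of_mul_le_mul_right h5 (by positivity)
    refine hkey 0 d le_rfl hd0.le ?_ hk0.le le_rfl
    have h5 : (T : ℝ) ≤ d * (u ^ 2 * a * w) := by
      calc (T : ℝ) = u ^ 2 * u := by rw [← hu3]; ring
        _ ≤ u ^ 2 * (d * a * w) := by gcongr
        _ = _ := by ring
    have : 0 ≤ d * (u ^ 2 * a * w) := by positivity
    linarith
  have hτ' : (0 : ℝ) < τ := Nat.cast_pos.2 hτpos
  have hτ2 : (τ : ℝ) ≤ 2 * τ₀ := by
    have := (Nat.ceil_lt_add_one hτ₀0.le).le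
    rw [← hτceil] at this
    linarith
  have hτ₀τ : τ₀ ≤ τ := by rw [hτceil]; exact Nat.le_ceil _
  have hn2 : (n : ℝ) * τ ≤ 2 * T := by
    have h3 := (Nat.ceil_lt_add_one (show 0 ≤ (T : ℝ) / τ by positivity)).le
    rw [← hn] at h3
    have h4 : (τ : ℝ) ≤ T := by exact_mod_cast hTτ
    calc (n : ℝ) * τ ≤ (T / τ + 1) * τ := by gcongr
      _ = T + τ := by field_simp
      _ ≤ 2 * T := by linarith
  have hfirst : τ * Real.sqrt (A * n) ≤ 2 * k * (u ^ 2 * a * w) := by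
    refine le_of_sq_le_sq ?_ (by positivity)
    rw [mul_pow, Real.sq_sqrt (by positivity)]
    calc (τ : ℝ) ^ 2 * (A * n) = A * (τ * (n * τ)) := by ring
      _ ≤ A * ((2 * (κ * (u * w ^ 2))) * (2 * T)) := by
          gcongr
          exact hτ2.trans (by gcongr)
      _ = (2 * k * (u ^ 2 * a * w)) ^ 2 := by rw [← ha2, ← hk2, ← hu3]; ring
  have hsecond : (n : ℝ) ≤ 2 * d * (u ^ 2 * a * w) := by
    have h5 : (n : ℝ) * (u * w ^ 2) ≤ (2 * d * (u ^ 2 * a * w)) * (u * w ^ 2) := by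
      calc (n : ℝ) * (u * w ^ 2) ≤ n * τ := by gcongr; exact hlo.trans hτ₀τ
        _ ≤ 2 * T * 1 := by linarith
        _ ≤ 2 * T * (d * a * w ^ 3) := by gcongr
        _ = _ := by rw [← hu3]; ring
    exact le_of_mul_le_mul_right h5 (by positivity)
  linarith

end PrivateBandit

end

theorem mainTheorem7 :
    (∀ (K T : ℕ) [NeZero K] (ε δ : ℝ), 1 ≤ T → 0 < ε → 0 < δ → δ < 1 →
      PrivateBandit.IsDifferentiallyPrivate
        (PrivateBandit.exp3Tau K T (PrivateBandit.blockLength T ε δ)) T ε δ) ∧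
    (∀ c : ℝ, 0 < c → ∃ C : ℝ, 0 < C ∧
      ∀ (K T : ℕ) [NeZero K] (ε δ : ℝ), 1 ≤ T → 0 < ε → 0 < δ → δ < 1 →
        ε ≤ c * Real.log (1 / δ) → ε ^ 2 ≤ c * (K * Real.log K * Real.log (1 / δ)) →
        ∀ (Ω : Type*) [MeasurableSpace Ω] (μ : MeasureTheory.Measure Ω)
          [MeasureTheory.IsProbabilityMeasure μ] (g : Ω → ℕ → Fin K → ℝ),
          (∀ t i, Measurable fun ω => g ω t i) → (∀ ω t i, g ω t i ∈ Set.Icc (0 : ℝ) 1) →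
          MeasureTheory.Integrable (fun ω => PrivateBandit.expectedRegret
            (PrivateBandit.exp3Tau K T (PrivateBandit.blockLength T ε δ))
            (PrivateBandit.switchingCosts (g ω)) T) μ ∧
          ∫ ω, PrivateBandit.expectedRegret
            (PrivateBandit.exp3Tau K T (PrivateBandit.blockLength T ε δ))
            (PrivateBandit.switchingCosts (g ω)) T ∂μ ≤
          C * ((T : ℝ) ^ (2 / 3 : ℝ) * Real.sqrt (K * Real.log K) *
            (Real.sqrt (Real.log (1 / δ)) / ε) ^ (1 / 3 : ℝ))) := by
  refine ⟨fun K T _ ε δ hT hε hδ hδ1 => PrivateBandit.isDifferentiallyPrivate_exp3Tau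
    (PrivateBandit.blockLength_pos hT hε hδ hδ1) hε hδ hδ1
    (PrivateBandit.le_blockLength_pow hε hδ hδ1), fun c hc =>
    ⟨8 * Real.sqrt ((4 * c + 2) ^ (1 / 3 : ℝ)) + 2 * Real.sqrt c, by positivity, ?_⟩⟩
  intro K T _ ε δ hT hε hδ hδ1 h1 h2 Ω _ μ _ g hg hg'
  have hint := PrivateBandit.integrable_expectedRegret_exp3Tau μ hg hg'
    (PrivateBandit.blockLength T ε δ) T
  refine ⟨hint, ?_⟩
  refine (integral_mono hint (integrable_const _) fun ω =>
    PrivateBandit.expectedRegret_exp3Tau_blockLength_le hc hT hε hδ hδ1 h1 h2 (hg' ω)).trans ?_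
  simp
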